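/- **Setting.** Let $\mathcal M=(\mathcal X,\mathcal A,H,P,R)$ be an episodic MDP with horizon $H$, a measurable state space $\mathcal X$, a finite action set with $|\mathcal A|=A\ge 1$, fixed initial state $x_1$, next states $x_{h+1}\sim P_h(\cdot\mid x_h,a_h)$ and rewards $r_h\sim R_h(x_h,a_h)$, where all rewards are nonnegative with finite mean and, for every action sequence, $\sum_{h=1}^H r_h\le 1$ almost surely. Write $V^\pi_h,Q^\pi_h$ for the value functions of a Markov policy $\pi$, $V^\star=\sup_\pi V_1^\pi(x_1)$, $Q^\star_h=\sup_\pi Q^\pi_h$, and $\mathbb E_\pi$ for the expectation over an episode under $\pi$. Let $\mathcal F=\mathcal F_1\times\dots\times\mathcal F_H$ be a class of measurable functions $\mathcal X\times\mathcal A\to[0,1]$, with $\mathcal F_{H+1}=\{0\}$; put $(\mathcal T_h g)(x,a)=\mathbb E[r_h+\max_{a'}g(x_{h+1},a')\mid x_h=x,a_h=a]$ and $\mathcal E_hf=f_h-\mathcal T_hf_{h+1}$. Assume $Q^\star_h\in\mathcal F_h$ and $\mathcal T_h\mathcal F_{h+1}\subseteq\mathcal F_h$ for all $h\in[H]$. Let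 $\pi^f$ be a greedy policy of $f$ (ties broken arbitrarily), $\Pi_{\mathcal F}=\{\pi^f:f\in\mathcal F\}$, and for $\epsilon\in(0,1]$ let $\mathrm{expl}(f)$ be the policy that plays $\pi^f$ with probability $1-\epsilon$ and a uniform action with probability $\epsilon$, independently at each step. **Algorithm.** Before each episode $t=1,2,\dots$, compute $\hat f_t\in\mathcal F$ backwards for $h=H,\dots,1$ as any least-squares minimizer, $\hat f_{t,h}\in\arg\min_{g\in\mathcal F_h}\sum(g(x_h,a_h)-r_h-\max_{a'}\hat f_{t,h+1}(x_{h+1},a'))^2$, the sum being over the transitions at step $h$ of all previous episodes; then sample episode $t$ with $\tilde\pi_t=\mathrm{expl}(\hat f_t)$. Let $\mathrm{Reg}(T)=\sum_{t=1}^T(V^\star-V_1^{\tilde\pi_t}(x_1))$. **Gap.** The myopic exploration gap $\alpha(f,\mathcal F)$ is the supremum of $\frac1{\sqrt c}\bigl(V_1^{\pi'}(x_1)-V_1^{\pi^f}(x_1)\bigr)$ over $\pi'\in\Pi_{\mathcal F}$ and $c\ge1$ such that for all $f'\in\mathcal F$ and $h\in[H]$ both $\mathbb E_{\pi'}[(\mathcal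 E_hf')^2(x_h,a_h)]$ and $\mathbb E_{\pi^f}[(\mathcal E_hf')^2(x_h,a_h)]$ are at most $c\,\mathbb E_{\mathrm{expl}(f)}[(\mathcal E_hf')^2(x_h,a_h)]$. Put $\alpha(\mathcal F',\mathcal F)=\inf_{f\in\mathcal F'}\alpha(f,\mathcal F)$ and $\mathcal F'_\lambda=\{f\in\mathcal F:V^\star-V_1^{\pi^f}(x_1)\ge\lambda\}$. **Complexity.** Let $\bar N_{\mathcal F}(r)=\sum_{h=1}^HN_{\mathcal F_h}(r)$ be the sum of the (internal) $\ell_\infty$ covering numbers. For a set $\mathcal G$ of functions, a set $\mathcal D$ of probability measures and $r>0$, let $\dim_{\mathrm{DE}}(\mathcal G,\mathcal D,r)$ be the length of the longest sequence $\rho_1,\dots,\rho_n$ in $\mathcal D$ for which there is $r'\ge r$ such that for each $i$ some $g\in\mathcal G$ has $\bigl(\sum_{j<i}(\mathbb E_{\rho_j}g)^2\bigr)^{1/2}\le r'<|\mathbb E_{\rho_i}g|$. The Bellman Eluder dimension is $\dim_{\mathrm{BE}}(\mathcal F,\Pi_{\mathcal F},r)=\max_{h\in[H]}\dim_{\mathrm{DE}}\bigl(\mathcal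 E_h\mathcal F,\{\text{law of }(x_h,a_h)\text{ under }\pi:\pi\in\Pi_{\mathcal F}\},r\bigr)$. **Theorem (Regret Bound of $\epsilon$-Greedy).** There is a universal $p\in\mathbb N$, and for every $\kappa>0$ a constant $C>0$ depending only on $\kappa$, such that the following holds. Let $T\ge1$, $\delta\in(0,1)$, $\epsilon\in(0,1]$, and let $h\in[1,H]$ be real with $$\alpha(\mathcal F'_\lambda,\mathcal F)\ \ge\ \kappa\,(\epsilon/A)^{h/2}\,\lambda\qquad\text{for all }\lambda\in[0,1].$$ Suppose that $\dim_{\mathrm{BE}}(\mathcal F,\Pi_{\mathcal F},1/\sqrt T)$ and $\bar N_{\mathcal F}(1/T)$ are finite, and put $$d=\max\{1,\dim_{\mathrm{BE}}(\mathcal F,\Pi_{\mathcal F},1/\sqrt T)\},\qquad K=\max\{1,\ln(\bar N_{\mathcal F}(1/T)/\delta)\},\qquad L=1+\ln(AT).$$ Then with probability at least $1-\delta$ $$\mathrm{Reg}(T)\ \le\ \epsilon HT+C\,L^p\sqrt{\frac{h\,A^h\,d\,H^3\,T}{\epsilon^h}\,K}.$$ Furthermore, let $B=\bigl(hHA^hdK/T\bigr)^{1/(h+2)}$.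 If $\min\{1,B\}/\rho_1\le\epsilon\le\rho_2B$ for some $\rho_1,\rho_2\ge1$, then with probability at least $1-\delta$ $$\mathrm{Reg}(T)\ \le\ C\,L^p\,(\rho_1^{h/2}+\rho_2)\,H^{\frac{h+3}{h+2}}\,T^{\frac{h+1}{h+2}}\,\bigl(h\,A^h\,d\,K\bigr)^{\frac1{h+2}};$$ in particular, for $\epsilon=\min\{1,B\}$, this is $\tilde O\bigl(H^{\frac{h+3}{h+2}}T^{\frac{h+1}{h+2}}(hA^hdK)^{\frac1{h+2}}\bigr)$. -/

import Mathlib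

open MeasureTheory ProbabilityTheory

universe u v w

noncomputable section

namespace MyopicRL

/-- An episodic MDP with state space `X` and action space `A`. Time steps are `0, …, H - 1`
(the data with index `≥ H` are never used; the final state may be any state, in particular a fixed
terminal one, as nothing is earned after the last step). At step `h`, in state `x` with action `a`, the reward is
drawn from `R h (x, a)` and, independently, the next state from `P h (x, a)`. -/
structure MDP (X : Type u) (A : Type v) [MeasurableSpace X] [MeasurableSpace A] where
  H : ℕ
  xInit : X
  P : ℕ → Kernel (X × A) X
  R : ℕ → Kernel (X × A) ℝ
  markov_P : ∀ h, IsMarkovKernel (P h)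
  markov_R : ∀ h, IsMarkovKernel (R h)

/-- A (randomized, Markov, time-dependent) policy. -/
structure Policy (X : Type u) (A : Type v) [MeasurableSpace X] [MeasurableSpace A] where
  ker : ℕ → Kernel X A
  markov : ∀ h, IsMarkovKernel (ker h)

/-- A sequence `f = (f_h)_h` of functions of state and action. -/
abbrev ValueFn (X : Type u) (A : Type v) := ℕ → X → A → ℝ

/-- A transition `(x_h, a_h, r_h, x_{h+1})`. -/
abbrev Transition (X : Type u) (A : Type v) := X × A × ℝ × X

section Policies

variable {X : Type u} {A : Type v} [MeasurableSpace X] [MeasurableSpace A]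

/-- The deterministic policy that plays `act h x` in state `x` at step `h`. -/
def Policy.ofAct (act : ℕ → X → A) (hact : ∀ h, Measurable (act h)) : Policy X A where
  ker h := Kernel.deterministic (act h) (hact h)
  markov _ := inferInstance

/-- The policy that plays `(1 - ε) δ_{act h x} + ε Unif(A)` in state `x` at step `h`. -/
def Policy.epsGreedy [Fintype A] [MeasurableSingletonClass A] [Nonempty A]
    (ε : ℝ) (hε : ε ∈ Set.Icc (0 : ℝ) 1)
    (act : ℕ → X → A) (hact : ∀ h, Measurable (act h)) : Policy X A where
  ker h :=
    { toFun := fun x => ENNReal.ofReal (1 - ε) • Measure.dirac (act h x)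
        + ENNReal.ofReal (ε / Fintype.card A) • Measure.count
      measurable' := by
        refine Measure.measurable_of_measurable_coe _ fun s hs => ?_
        simp only [Measure.coe_add, Measure.coe_smul, Pi.add_apply, Pi.smul_apply, smul_eq_mul]
        refine Measurable.add_const (Measurable.const_mul ?_ _) _
        exact (Measure.measurable_coe hs).comp (Measure.measurable_dirac.comp (hact h)) }
  markov h := ⟨fun x => ⟨by
    change (ENNReal.ofReal (1 - ε) • Measure.dirac (act h x)
        + ENNReal.ofReal (ε / Fintype.card A) • Measure.count : Measure A) Set.univ = 1
    have hA : (0 : ℝ) < Fintype.card A := by exact_mod_cast Fintype.card_pos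
    have h1 : (0 : ℝ) ≤ 1 - ε := by linarith [hε.2]
    have h2 : (0 : ℝ) ≤ ε / Fintype.card A := div_nonneg hε.1 hA.le
    simp only [Measure.coe_add, Measure.coe_smul, Pi.add_apply, Pi.smul_apply, smul_eq_mul,
      measure_univ, mul_one, Measure.count_univ, ENat.card_eq_coe_fintype_card]
    have h3 : (((Fintype.card A : ℕ) : ENat) : ENNReal)
        = ENNReal.ofReal (Fintype.card A) := by simp
    rw [h3, ← ENNReal.ofReal_mul h2, div_mul_cancel₀ _ hA.ne', ← ENNReal.ofReal_add h1 hε.1]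
    simp⟩⟩

end Policies

namespace MDP

variable {X : Type u} {A : Type v} [MeasurableSpace X] [MeasurableSpace A]

/-- An episode, as the sequence of its transitions. -/
abbrev Episode (M : MDP X A) := Fin M.H → Transition X A

/-- The law of `(x, a, r, x')` when at step `h` the policy acts in state `x`. -/
def stepKernel (M : MDP X A) (π : Policy X A) (h : ℕ) : Kernel X (Transition X A) :=
  Kernel.id ×ₖ (π.ker h ⊗ₖ (M.R h ×ₖ M.P h))

/-- The joint law of the first `n` transitions and of the state reached after them. -/
def prefixLaw (M : MDP X A) (π : Policy X A) : (n : ℕ) → Measure ((Fin n → Transition X A) × X)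
  | 0 => Measure.dirac (fun i => i.elim0, M.xInit)
  | n + 1 =>
    (M.prefixLaw π n ⊗ₘ (M.stepKernel π n).comap Prod.snd measurable_snd).map
      fun p => (Fin.snoc (α := fun _ => Transition X A) p.1.1 p.2, p.2.2.2.2)

/-- The law `ℙ_π` of an episode. -/
def law (M : MDP X A) (π : Policy X A) : Measure M.Episode :=
  (M.prefixLaw π M.H).map Prod.fst

/-- The occupancy measure of `π` at step `h`: the law of `(x_h, a_h)` under `ℙ_π`. -/
def occ (M : MDP X A) (π : Policy X A) (h : Fin M.H) : Measure (X × A) :=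
  (M.law π).map fun e => ((e h).1, (e h).2.1)

/-- Rewards are nonnegative (with finite mean), and for every action sequence the sum of the rewards
of an episode is almost surely at most `1`. -/
structure RewardBounded (M : MDP X A) : Prop where
  nonneg : ∀ h < M.H, ∀ x a, ∀ᵐ r ∂M.R h (x, a), 0 ≤ r
  integrable : ∀ h < M.H, ∀ x a, Integrable (fun r : ℝ => r) (M.R h (x, a))
  sum_le_one : ∀ a : ℕ → A,
    ∀ᵐ e ∂M.law (Policy.ofAct (fun h _ => a h) fun _ => measurable_const),
      ∑ h, (e h).2.2.1 ≤ 1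

/-- The mean reward. -/
def meanReward (M : MDP X A) (h : ℕ) (x : X) (a : A) : ℝ := ∫ r, r ∂M.R h (x, a)

/-- The value of `π` with `k` steps to go, that is, from step `H - k` on. -/
def valueToGo (M : MDP X A) (π : Policy X A) : ℕ → X → ℝ
  | 0, _ => 0
  | k + 1, x => ∫ a, (M.meanReward (M.H - (k + 1)) x a
      + ∫ y, M.valueToGo π k y ∂M.P (M.H - (k + 1)) (x, a)) ∂π.ker (M.H - (k + 1)) x

/-- The value function `V_h^π`. -/
def V (M : MDP X A) (π : Policy X A) (h : ℕ) (x : X) : ℝ := M.valueToGo π (M.H - h) x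

/-- The Q-function `Q_h^π`. -/
def Q (M : MDP X A) (π : Policy X A) (h : ℕ) (x : X) (a : A) : ℝ :=
  M.meanReward h x a + ∫ y, M.V π (h + 1) y ∂M.P h (x, a)

/-- The return of `π`: its value at the initial state and the first step. -/
def ret (M : MDP X A) (π : Policy X A) : ℝ := M.V π 0 M.xInit

/-- The optimal Q-function. -/
def Qstar (M : MDP X A) (h : ℕ) (x : X) (a : A) : ℝ := ⨆ π : Policy X A, M.Q π h x a

/-- The optimal return. -/
def optRet (M : MDP X A) : ℝ := ⨆ π : Policy X A, M.ret π

/-- The Bellman operator `𝒯_h` (for finite `A`, the supremum over actions is a maximum). -/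
def bellman (M : MDP X A) (h : ℕ) (f : X → A → ℝ) (x : X) (a : A) : ℝ :=
  M.meanReward h x a + ∫ y, (⨆ a', f y a') ∂M.P h (x, a)

/-- The Bellman residual `ℰ_h f = f_h - 𝒯_h f_{h+1}`. -/
def residual (M : MDP X A) (h : ℕ) (f : ValueFn X A) (p : X × A) : ℝ :=
  f h p.1 p.2 - M.bellman h (f (h + 1)) p.1 p.2

end MDP

variable {X : Type u} {A : Type v} [MeasurableSpace X] [MeasurableSpace A]

/-- A function class `ℱ = ℱ_0 × ⋯ × ℱ_{H-1}` of measurable functions with values in `[0, 1]`, extended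
by `ℱ_h = {0}` for `h ≥ H`. -/
structure FnClass (M : MDP X A) where
  part : ℕ → Set (X → A → ℝ)
  measurable : ∀ h, ∀ f ∈ part h, Measurable fun p : X × A => f p.1 p.2
  mem_Icc : ∀ h, ∀ f ∈ part h, ∀ x a, f x a ∈ Set.Icc (0 : ℝ) 1
  terminal : ∀ h, M.H ≤ h → part h = {0}

namespace FnClass

variable {M : MDP X A}

/-- The elements `f = (f_h)_h` of the class. -/
def fns (F : FnClass M) : Set (ValueFn X A) := {f | ∀ h, f h ∈ F.part h}

/-- Realizability and completeness. -/
structure Complete (F : FnClass M) : Prop where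
  realizable : ∀ h < M.H, M.Qstar h ∈ F.part h
  complete : ∀ h < M.H, ∀ f ∈ F.part (h + 1), M.bellman h f ∈ F.part h

/-- The `ℓ_∞` covering number of `ℱ_h` at radius `r`. -/
def coverNum (F : FnClass M) (h : ℕ) (r : ℝ) : ℕ∞ :=
  ⨅ (Z : Set (X → A → ℝ)) (_ : Z ⊆ F.part h)
    (_ : ∀ f ∈ F.part h, ∃ g ∈ Z, ∀ x a, |f x a - g x a| ≤ r), Z.encard

/-- The sum of the covering numbers over the steps. -/
def coverSum (F : FnClass M) (r : ℝ) : ℕ∞ := ∑ h ∈ Finset.range M.H, F.coverNum h r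

end FnClass

/-- A choice of one greedy policy `π^f` for each `f` of the class (ties are broken arbitrarily). -/
structure Greedy {M : MDP X A} (F : FnClass M) where
  act : ValueFn X A → ℕ → X → A
  measurable : ∀ f h, Measurable (act f h)
  greedy : ∀ f ∈ F.fns, ∀ h < M.H, ∀ x a, f h x a ≤ f h x (act f h x)

section Greedy

variable {M : MDP X A} {F : FnClass M}

/-- The greedy policy `π^f`. -/
def Greedy.policy (G : Greedy F) (f : ValueFn X A) : Policy X A :=
  Policy.ofAct (G.act f) (G.measurable f)

/-- The set of greedy policies of the class. -/
def Greedy.policies (G : Greedy F) : Set (Policy X A) := G.policy '' F.fns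

/-- The exploration mapping of `ε`-greedy. -/
def Greedy.explore [Fintype A] [MeasurableSingletonClass A] [Nonempty A] (G : Greedy F)
    (ε : ℝ) (hε : ε ∈ Set.Icc (0 : ℝ) 1) (f : ValueFn X A) : Policy X A :=
  Policy.epsGreedy ε hε (G.act f) (G.measurable f)

/-- The functions of the class whose greedy policy is at least `l` suboptimal. -/
def Greedy.suboptimal (G : Greedy F) (l : ℝ) : Set (ValueFn X A) :=
  {f ∈ F.fns | l ≤ M.optRet - M.ret (G.policy f)}

/-- The myopic exploration gap `α(f, ℱ, Π')` for the exploration mapping `expl`. -/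
def gap (G : Greedy F) (expl : ValueFn X A → Policy X A) (Pi' : Set (Policy X A))
    (f : ValueFn X A) : EReal :=
  ⨆ (π' ∈ Pi') (c : ℝ) (_ : 1 ≤ c)
    (_ : ∀ f' ∈ F.fns, ∀ h : Fin M.H,
      ∫ p, M.residual h f' p ^ 2 ∂M.occ π' h ≤ c * ∫ p, M.residual h f' p ^ 2 ∂M.occ (expl f) h ∧
      ∫ p, M.residual h f' p ^ 2 ∂M.occ (G.policy f) h
        ≤ c * ∫ p, M.residual h f' p ^ 2 ∂M.occ (expl f) h),
    ((1 / √c * (M.ret π' - M.ret (G.policy f)) : ℝ) : EReal)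

/-- The gap `α(ℱ', ℱ)` of a subset `ℱ'` of the class: the infimum of `α(f, ℱ)` over `f ∈ ℱ'`, with
the set of greedy policies of the class as the comparison policies. -/
def gapOn (G : Greedy F) (expl : ValueFn X A → Policy X A) (F' : Set (ValueFn X A)) : EReal :=
  ⨅ f ∈ F', gap G expl G.policies f

end Greedy

/-- `ν` is `ε`-independent of `ρ_0, …, ρ_{n-1}` with respect to `𝒢`. -/
def EpsIndep {S : Type*} [MeasurableSpace S] (𝒢 : Set (S → ℝ)) (ε : ℝ) (ν : Measure S) {n : ℕ}
    (ρ : Fin n → Measure S) : Prop :=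
  ∃ g ∈ 𝒢, √(∑ i, (∫ s, g s ∂ρ i) ^ 2) ≤ ε ∧ ε < |∫ s, g s ∂ν|

/-- The distributional Eluder dimension. -/
def dimDE {S : Type*} [MeasurableSpace S] (𝒢 : Set (S → ℝ)) (D : Set (Measure S)) (ε : ℝ) : ℕ∞ :=
  ⨆ (n : ℕ) (_ : ∃ ρ : Fin n → Measure S, (∀ i, ρ i ∈ D) ∧ ∃ ε' : ℝ, ε ≤ ε' ∧
    ∀ i : Fin n, EpsIndep 𝒢 ε' (ρ i) fun j : Fin i => ρ (Fin.castLE i.isLt.le j)), (n : ℕ∞)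

/-- The Bellman Eluder dimension of the class with respect to a set of policies, which enters through
its occupancy measures. -/
def dimBE {M : MDP X A} (F : FnClass M) (Pi' : Set (Policy X A)) (ε : ℝ) : ℕ∞ :=
  ⨆ h : Fin M.H, dimDE (M.residual h '' F.fns) ((fun π => M.occ π h) '' Pi') ε

/-- The squared loss at step `h` on the data of the episodes `0, …, t - 1`. -/
def sqLoss {M : MDP X A} (data : ℕ → M.Episode) (t : ℕ) (h : Fin M.H) (f f' : X → A → ℝ) : ℝ :=
  ∑ s ∈ Finset.range t,
    (f (data s h).1 (data s h).2.1 - (data s h).2.2.1 - ⨆ a', f' (data s h).2.2.2 a') ^ 2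

/-- A run of fitted Q-iteration with exploration mapping `expl` on a probability space.
`ℋ t` is the information available just before episode `t`, `fhat t` the estimate computed then, and
`ep t` the episode that is sampled next. Ties in the regression are broken arbitrarily. -/
structure Run {M : MDP X A} (F : FnClass M) (expl : ValueFn X A → Policy X A)
    {Ω : Type w} [mΩ : MeasurableSpace Ω] (μ : Measure Ω) where
  ℋ : Filtration ℕ mΩ
  fhat : ℕ → Ω → ValueFn X A
  ep : ℕ → Ω → M.Episode
  /-- The estimate is determined by the available information. -/
  fhat_adapted : ∀ t h x a, Measurable[ℋ t] fun ω => fhat t ω h x a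
  /-- A completed episode is part of the available information. -/
  ep_adapted : ∀ t, Measurable[ℋ (t + 1)] (ep t)
  /-- The estimate lies in the class, and in particular vanishes at the terminal step. -/
  fhat_mem : ∀ t, ∀ᵐ ω ∂μ, fhat t ω ∈ F.fns
  /-- The estimate solves the least-squares problems exactly. -/
  fhat_argmin : ∀ t, ∀ᵐ ω ∂μ, ∀ h : Fin M.H, ∀ g ∈ F.part h,
    sqLoss (fun s => ep s ω) t h (fhat t ω h) (fhat t ω (h + 1))
      ≤ sqLoss (fun s => ep s ω) t h g (fhat t ω (h + 1))
  /-- Given the available information, the episode is sampled with the exploration policy. -/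
  ep_law : ∀ t, ∀ S : Set M.Episode, MeasurableSet S →
    μ[(ep t ⁻¹' S).indicator (fun _ => (1 : ℝ)) | ℋ t]
      =ᵐ[μ] fun ω => (M.law (expl (fhat t ω))).real S

/-- The regret of the sampling policies over the episodes `0, …, T - 1`. -/
def Run.regret {M : MDP X A} {F : FnClass M} {expl : ValueFn X A → Policy X A}
    {Ω : Type w} [MeasurableSpace Ω] {μ : Measure Ω} (run : Run F expl μ) (T : ℕ) (ω : Ω) : ℝ :=
  ∑ t ∈ Finset.range T, (M.optRet - M.ret (expl (run.fhat t ω)))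

end MyopicRL

end

/-! The regret has two sources. Uniform actions cost at most εH per episode, because the exploration
policy dominates (1 - ε) times the greedy one at each step and rewards are nonnegative
(`RewardBounded.ret_sub_le_ret_epsGreedy`). What remains is the sum of the gaps r_t = V⋆ - V^{π_t},
where π_t is the greedy policy of the estimate f_t; it is controlled by counting, at each level l,
the episodes with r_t ≥ l.

Regression. The excess squared loss of g over 𝒯f has mean E(g - 𝒯f)² and a second moment of the same
order, so its exponential moments give a supermartingale without a square-root loss. By completeness
𝒯f_t competes in the least-squares problem, so the excess loss of f_t is nonpositive. A union bound
over 1/T-covers then yields, with probability 1 - δ, a bound β = O(log(TN²/δ)), valid for all t < T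
and all steps, on the squared residuals of f_t summed over the past exploration policies
(`Run.measure_residual_le`).

Gap. Put q = κ(ε/A)^{h/2}. If r_t ≥ l, the gap provides c and a policy π' that beats π_t by more
than √c·ql/2, both policies being dominated by exploration with constant c. By the policy loss
decomposition (`Greedy.ret_sub_ret_le`), one of the two has, at some step, a mean residual larger
than √c·η, where η = ql/(4H) (`Greedy.exists_large_residual`).

Counting. Group these episodes by that step and by the dyadic scale 2^j of c. Inside a group, the
residual of f_t has squared means summing to at most 2^{j+1}β over the earlier detecting policies,
and a mean above 2^{j/2}η on its own. The scale cancels in the ratio, so splitting a group into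
about 2β/η² independent sequences bounds its size by about dβ/η² (`exists_coloring`,
`Greedy.card_suboptimal_le`). There are H steps and O(h log(AT)) scales, with κ hidden in the
constant, so #{t : r_t ≥ l} ≤ Q/l² down to l = 1/T, and this weak-L² bound sums to 1 + 2√(QT)
(`sum_le_two_mul_sqrt`). The second bound follows by taking ε near the value B that balances the two
terms. -/

noncomputable section

/-! ### Marginals of the law of an episode -/

namespace MyopicRL

attribute [instance] MDP.markov_P MDP.markov_R Policy.markov

namespace MDP

variable {X : Type u} {A : Type v} [MeasurableSpace X] [MeasurableSpace A]
  (M : MDP X A) (π : Policy X A)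

instance isMarkovKernel_stepKernel (h : ℕ) : IsMarkovKernel (M.stepKernel π h) := by
  unfold stepKernel; infer_instance

theorem measurable_snoc (n : ℕ) :
    Measurable fun p : ((Fin n → Transition X A) × X) × Transition X A =>
      ((Fin.snoc (α := fun _ => Transition X A) p.1.1 p.2 : Fin (n + 1) → Transition X A),
        p.2.2.2.2) := by
  refine Measurable.prodMk ?_ (by fun_prop)
  refine measurable_pi_iff.2 fun i => ?_
  refine Fin.lastCases ?_ (fun j => ?_) i
  · simp only [Fin.snoc_last]; fun_prop
  · simp only [Fin.snoc_castSucc]; fun_prop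

instance isProbabilityMeasure_prefixLaw (n : ℕ) : IsProbabilityMeasure (M.prefixLaw π n) := by
  induction n with
  | zero => unfold prefixLaw; infer_instance
  | succ n ih =>
    unfold prefixLaw
    exact Measure.isProbabilityMeasure_map (measurable_snoc n).aemeasurable

instance isProbabilityMeasure_law : IsProbabilityMeasure (M.law π) :=
  Measure.isProbabilityMeasure_map measurable_fst.aemeasurable

/-- The law of the state at step `n`. -/
def stateLaw (n : ℕ) : Measure X := (M.prefixLaw π n).map Prod.snd

instance isProbabilityMeasure_stateLaw (n : ℕ) : IsProbabilityMeasure (M.stateLaw π n) :=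
  Measure.isProbabilityMeasure_map measurable_snd.aemeasurable

/-- The law of the state and the action at step `n`. -/
def saLaw (n : ℕ) : Measure (X × A) := M.stateLaw π n ⊗ₘ π.ker n

instance isProbabilityMeasure_saLaw (n : ℕ) : IsProbabilityMeasure (M.saLaw π n) := by
  unfold saLaw; infer_instance

/-- The law of the transition at step `n`. -/
def trLaw (n : ℕ) : Measure (Transition X A) :=
  (M.saLaw π n ⊗ₘ (M.R n ×ₖ M.P n)).map fun p => (p.1.1, p.1.2, p.2)

instance isProbabilityMeasure_trLaw (n : ℕ) : IsProbabilityMeasure (M.trLaw π n) :=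
  Measure.isProbabilityMeasure_map (by fun_prop)

theorem lintegral_stepKernel (h : ℕ) (x : X) {φ : Transition X A → ENNReal} (hφ : Measurable φ) :
    ∫⁻ p, φ p ∂M.stepKernel π h x
      = ∫⁻ a, ∫⁻ q, φ (x, a, q) ∂(M.R h ×ₖ M.P h) (x, a) ∂π.ker h x := by
  rw [stepKernel, Kernel.prod_apply, Kernel.id_apply, Measure.dirac_prod,
    lintegral_map hφ (by fun_prop), Kernel.lintegral_compProd _ _ _ (by fun_prop)]

theorem lintegral_trLaw (n : ℕ) {φ : Transition X A → ENNReal} (hφ : Measurable φ) :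
    ∫⁻ p, φ p ∂M.trLaw π n = ∫⁻ x, ∫⁻ p, φ p ∂M.stepKernel π n x ∂M.stateLaw π n := by
  rw [trLaw, lintegral_map hφ (by fun_prop), Measure.lintegral_compProd (by fun_prop), saLaw,
    Measure.lintegral_compProd]
  · exact lintegral_congr fun x => (M.lintegral_stepKernel π n x hφ).symm
  · exact Measurable.lintegral_kernel_prod_right' (κ := M.R n ×ₖ M.P n)
      (f := fun p : (X × A) × (ℝ × X) => φ (p.1.1, p.1.2, p.2)) (by fun_prop)

theorem lintegral_prefixLaw_succ (n : ℕ) {φ : ((Fin (n + 1) → Transition X A) × X) → ENNReal}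
    (hφ : Measurable φ) :
    ∫⁻ p, φ p ∂M.prefixLaw π (n + 1)
      = ∫⁻ p, ∫⁻ q, φ (Fin.snoc (α := fun _ => Transition X A) p.1 q, q.2.2.2)
          ∂M.stepKernel π n p.2 ∂M.prefixLaw π n := by
  rw [prefixLaw, lintegral_map hφ (measurable_snoc n)]
  exact Measure.lintegral_compProd (hφ.comp (measurable_snoc n))

theorem prefixLaw_map_last (n : ℕ) :
    (M.prefixLaw π (n + 1)).map (fun p => p.1 (Fin.last n)) = M.trLaw π n := by
  refine Measure.ext_of_lintegral _ fun φ hφ => ?_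
  rw [lintegral_map hφ (by fun_prop), lintegral_prefixLaw_succ _ _ _ (by fun_prop),
    lintegral_trLaw _ _ _ hφ, stateLaw, lintegral_map (hφ.lintegral_kernel) measurable_snd]
  simp

theorem stateLaw_succ (n : ℕ) :
    M.stateLaw π (n + 1) = (M.trLaw π n).map fun p => p.2.2.2 := by
  refine Measure.ext_of_lintegral _ fun φ hφ => ?_
  rw [stateLaw, lintegral_map hφ measurable_snd, lintegral_prefixLaw_succ _ _ _ (by fun_prop),
    lintegral_map hφ (by fun_prop), lintegral_trLaw _ _ _ (by fun_prop), stateLaw,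
    lintegral_map (Measurable.lintegral_kernel (by fun_prop)) measurable_snd]

theorem prefixLaw_map_castSucc (n : ℕ) (i : Fin n) :
    (M.prefixLaw π (n + 1)).map (fun p => p.1 i.castSucc) = (M.prefixLaw π n).map fun p => p.1 i := by
  refine Measure.ext_of_lintegral _ fun φ hφ => ?_
  rw [lintegral_map hφ (by fun_prop), lintegral_prefixLaw_succ _ _ _ (by fun_prop),
    lintegral_map hφ (by fun_prop)]
  simp

theorem prefixLaw_map_eval (n : ℕ) (i : Fin n) :
    (M.prefixLaw π n).map (fun p => p.1 i) = M.trLaw π i := by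
  induction n with
  | zero => exact i.elim0
  | succ n ih =>
    refine Fin.lastCases ?_ (fun j => ?_) i
    · simpa using M.prefixLaw_map_last π n
    · rw [prefixLaw_map_castSucc, ih]; rfl

theorem law_map_eval (h : Fin M.H) : (M.law π).map (fun e => e h) = M.trLaw π h := by
  rw [law, Measure.map_map (by fun_prop) (by fun_prop), ← M.prefixLaw_map_eval π M.H h]
  rfl

theorem trLaw_map_sa (n : ℕ) : (M.trLaw π n).map (fun p => (p.1, p.2.1)) = M.saLaw π n := by
  rw [trLaw, Measure.map_map (by fun_prop) (by fun_prop)]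
  exact Measure.fst_compProd _ _

/-- The occupancy measure is a marginal of the law of the whole episode; as a composition product
with the policy it becomes accessible to recursion on the step. -/
theorem occ_eq (h : Fin M.H) : M.occ π h = M.saLaw π h := by
  rw [occ, ← trLaw_map_sa, ← law_map_eval, Measure.map_map (by fun_prop) (by fun_prop)]
  rfl

instance isProbabilityMeasure_occ (h : Fin M.H) : IsProbabilityMeasure (M.occ π h) := by
  rw [occ_eq]; infer_instance

theorem stateLaw_zero : M.stateLaw π 0 = Measure.dirac M.xInit := by
  rw [stateLaw, prefixLaw, Measure.map_dirac' measurable_snd]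

theorem trLaw_map_reward (n : ℕ) :
    (M.trLaw π n).map (fun p => ((p.1, p.2.1), p.2.2.1)) = M.saLaw π n ⊗ₘ M.R n := by
  rw [trLaw, Measure.map_map (by fun_prop) (by fun_prop)]
  refine Measure.ext_of_lintegral _ fun φ hφ => ?_
  rw [lintegral_map hφ (by fun_prop), Measure.lintegral_compProd (by fun_prop),
    Measure.lintegral_compProd hφ]
  refine lintegral_congr fun p => ?_
  rw [Kernel.prod_apply, lintegral_prod _ (by fun_prop)]
  simp

theorem trLaw_map_next (n : ℕ) :
    (M.trLaw π n).map (fun p => ((p.1, p.2.1), p.2.2.2)) = M.saLaw π n ⊗ₘ M.P n := by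
  rw [trLaw, Measure.map_map (by fun_prop) (by fun_prop)]
  refine Measure.ext_of_lintegral _ fun φ hφ => ?_
  rw [lintegral_map hφ (by fun_prop), Measure.lintegral_compProd (by fun_prop),
    Measure.lintegral_compProd hφ]
  refine lintegral_congr fun p => ?_
  rw [Kernel.prod_apply, lintegral_prod _ (by fun_prop)]
  simp

theorem stateLaw_succ' (n : ℕ) :
    M.stateLaw π (n + 1) = (M.saLaw π n ⊗ₘ M.P n).map Prod.snd := by
  rw [stateLaw_succ, ← trLaw_map_next, Measure.map_map (by fun_prop) (by fun_prop)]
  rfl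

/-- The policy that plays a fixed sequence of actions. -/
abbrev openLoop (a : ℕ → A) : Policy X A := Policy.ofAct (fun h _ => a h) fun _ => measurable_const

theorem prefixLaw_openLoop_congr (n : ℕ) {a b : ℕ → A} (hab : ∀ i < n, a i = b i) :
    M.prefixLaw (openLoop a) n = M.prefixLaw (openLoop b) n := by
  induction n with
  | zero => rw [prefixLaw, prefixLaw]
  | succ n ih =>
    refine Measure.ext_of_lintegral _ fun φ hφ => ?_
    rw [lintegral_prefixLaw_succ _ _ _ hφ, lintegral_prefixLaw_succ _ _ _ hφ,
      ih fun i hi => hab i (hi.trans (Nat.lt_succ_self n))]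
    have hk : (openLoop (X := X) a).ker n = (openLoop b).ker n := by
      refine Kernel.ext fun x => ?_
      simp [openLoop, Policy.ofAct, Kernel.deterministic_apply, hab n (Nat.lt_succ_self n)]
    rw [stepKernel, stepKernel, hk]

/-- An event of positive probability under some policy has positive probability under some
sequence of actions. -/
theorem lintegral_prefixLaw_eq_zero [MeasurableSingletonClass A] [Fintype A] (n : ℕ)
    {φ : ((Fin n → Transition X A) × X) → ENNReal} (hφ : Measurable φ)
    (h0 : ∀ a : ℕ → A, ∫⁻ p, φ p ∂M.prefixLaw (openLoop a) n = 0) :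
    ∫⁻ p, φ p ∂M.prefixLaw π n = 0 := by
  induction n with
  | zero =>
    -- The hypothesis needs at least one action sequence; one exists because the policy puts mass 1
    -- on the action space.
    by_cases hA : Nonempty A
    · exact h0 fun _ => hA.some
    · exfalso
      have : IsEmpty A := not_nonempty_iff.1 hA
      have h1 := (π.markov 0).isProbabilityMeasure M.xInit
      have h2 : (π.ker 0 M.xInit) Set.univ = 1 := h1.measure_univ
      rw [Set.univ_eq_empty_iff.2 this, measure_empty] at h2
      exact zero_ne_one h2
  | succ n ih =>
    let ψ : A → ((Fin n → Transition X A) × X) → ENNReal := fun a p =>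
      ∫⁻ q, φ (Fin.snoc (α := fun _ => Transition X A) p.1 (p.2, a, q), q.2)
        ∂(M.R n ×ₖ M.P n) (p.2, a)
    have hstep : ∀ (π : Policy X A), ∫⁻ p, φ p ∂M.prefixLaw π (n + 1)
        = ∫⁻ p, ∫⁻ a, ψ a p ∂π.ker n p.2 ∂M.prefixLaw π n := by
      intro π
      rw [lintegral_prefixLaw_succ _ _ _ hφ]
      refine lintegral_congr fun p => ?_
      exact M.lintegral_stepKernel π n p.2 (hφ.comp ((measurable_snoc n).comp (by fun_prop :
        Measurable fun q : Transition X A => (p, q))))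
    have hψ : ∀ a, Measurable (ψ a) := by
      intro a
      refine Measurable.lintegral_kernel_prod_right'
        (κ := (M.R n ×ₖ M.P n).comap (fun p : (Fin n → Transition X A) × X => (p.2, a))
          (by fun_prop))
        (f := fun p : ((Fin n → Transition X A) × X) × (ℝ × X) =>
          φ (Fin.snoc (α := fun _ => Transition X A) p.1.1 (p.1.2, a, p.2), p.2.2)) ?_
      exact hφ.comp ((measurable_snoc n).comp (by fun_prop :
        Measurable fun q : ((Fin n → Transition X A) × X) × (ℝ × X) => (q.1, (q.1.2, a, q.2))))
    have hnull : ∀ a, ∫⁻ p, ψ a p ∂M.prefixLaw π n = 0 := by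
      intro a
      refine ih (hψ a) fun b => ?_
      -- Changing the action at step `n` leaves the law of the first `n` transitions unchanged, so
      -- null sets can be handled one last action at a time.
      have h1 := h0 (Function.update b n a)
      rw [hstep] at h1
      rw [M.prefixLaw_openLoop_congr n (b := Function.update b n a)
        fun i hi => by simp [Function.update_of_ne hi.ne]]
      rw [← h1]
      refine lintegral_congr fun p => ?_
      simp [openLoop, Policy.ofAct]
    rw [hstep]
    have hall : ∀ᵐ p ∂M.prefixLaw π n, ∀ a, ψ a p = 0 := by
      rw [ae_all_iff]
      intro a
      exact (lintegral_eq_zero_iff (hψ a)).1 (hnull a)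
    refine (lintegral_congr_ae (g := fun _ => 0) ?_).trans (by simp)
    filter_upwards [hall] with p hp
    simp [hp]

/-- This transfers the bound on the total reward, which is assumed for fixed action sequences only,
to all policies. It works because there are finitely many actions at each step. -/
theorem ae_law_of_openLoop [MeasurableSingletonClass A] [Fintype A] {S : Set M.Episode}
    (hS : MeasurableSet S) (h0 : ∀ a : ℕ → A, ∀ᵐ e ∂M.law (openLoop a), e ∈ S) :
    ∀ᵐ e ∂M.law π, e ∈ S := by
  have key : ∀ π : Policy X A, M.law π Sᶜ
      = ∫⁻ p, (Sᶜ.indicator (fun _ => 1) p.1 : ENNReal) ∂M.prefixLaw π M.H := by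
    intro π
    rw [law, ← lintegral_map (f := Sᶜ.indicator fun _ => (1 : ENNReal))
      (measurable_const.indicator hS.compl) measurable_fst, lintegral_indicator hS.compl]
    simp
  change M.law π Sᶜ = 0
  rw [key]
  refine M.lintegral_prefixLaw_eq_zero π _
    ((measurable_const.indicator hS.compl).comp measurable_fst) fun a => ?_
  rw [← key]
  exact h0 a

end MDP
end MyopicRL

/-! ### Returns as sums of expected mean rewards -/

namespace MyopicRL

theorem _root_.MeasureTheory.Integrable.integral_measure_compProd {α β : Type*}
    [MeasurableSpace α] [MeasurableSpace β] {μ : Measure α} [SFinite μ] {κ : Kernel α β}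
    [IsSFiniteKernel κ] {f : α × β → ℝ} (hf : Integrable f (μ ⊗ₘ κ)) :
    Integrable (fun x => ∫ y, f (x, y) ∂κ x) μ := by
  rw [Measure.compProd] at hf
  simpa using hf.integral_compProd

namespace MDP

variable {X : Type u} {A : Type v} [MeasurableSpace X] [MeasurableSpace A]
  {M : MDP X A} (π : Policy X A)

theorem measurable_eval (h : Fin M.H) : Measurable fun e : M.Episode => e h :=
  measurable_pi_apply h

theorem stronglyMeasurable_meanReward (h : ℕ) :
    StronglyMeasurable fun p : X × A => M.meanReward h p.1 p.2 :=
  StronglyMeasurable.integral_kernel_prod_right' (κ := M.R h)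
    (f := fun q : (X × A) × ℝ => q.2) measurable_snd.stronglyMeasurable

theorem stronglyMeasurable_integral_P (h : ℕ) {g : X → ℝ} (hg : StronglyMeasurable g) :
    StronglyMeasurable fun p : X × A => ∫ y, g y ∂M.P h p :=
  StronglyMeasurable.integral_kernel_prod_right' (κ := M.P h)
    (f := fun q : (X × A) × X => g q.2) (hg.comp_measurable measurable_snd)

theorem stronglyMeasurable_valueToGo (k : ℕ) : StronglyMeasurable (M.valueToGo π k) := by
  induction k with
  | zero =>
    have h0 : M.valueToGo π 0 = fun _ => 0 := by funext x; rw [valueToGo]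
    rw [h0]
    exact stronglyMeasurable_const
  | succ k ih =>
    have hV : M.valueToGo π (k + 1) = fun x => ∫ a, (M.meanReward (M.H - (k + 1)) x a
        + ∫ y, M.valueToGo π k y ∂M.P (M.H - (k + 1)) (x, a)) ∂π.ker (M.H - (k + 1)) x := by
      funext x; rw [valueToGo]
    rw [hV]
    exact StronglyMeasurable.integral_kernel_prod_right' (κ := π.ker (M.H - (k + 1)))
      ((stronglyMeasurable_meanReward _).add (stronglyMeasurable_integral_P _ ih))

theorem RewardBounded.ae_nonneg_trLaw (hM : M.RewardBounded) {h : ℕ} (hh : h < M.H) :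
    ∀ᵐ p ∂M.trLaw π h, 0 ≤ p.2.2.1 := by
  have h1 : ∀ᵐ q ∂M.saLaw π h ⊗ₘ M.R h, 0 ≤ q.2 := by
    refine Measure.ae_compProd_of_ae_ae (measurableSet_le measurable_const measurable_snd) ?_
    exact Filter.Eventually.of_forall fun p => hM.nonneg h hh p.1 p.2
  rw [← trLaw_map_reward] at h1
  exact ae_of_ae_map (p := fun q : (X × A) × ℝ => 0 ≤ q.2)
    (by fun_prop) h1

theorem RewardBounded.ae_law_nonneg (hM : M.RewardBounded) :
    ∀ᵐ e ∂M.law π, ∀ h : Fin M.H, 0 ≤ (e h).2.2.1 := by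
  rw [ae_all_iff]
  intro h
  have h1 := hM.ae_nonneg_trLaw π h.2
  rw [← law_map_eval] at h1
  exact ae_of_ae_map (p := fun q : Transition X A => 0 ≤ q.2.2.1)
    (measurable_eval h).aemeasurable h1

theorem RewardBounded.meanReward_nonneg (hM : M.RewardBounded) {h : ℕ} (hh : h < M.H) (x : X)
    (a : A) : 0 ≤ M.meanReward h x a :=
  integral_nonneg_of_ae (hM.nonneg h hh x a)

variable [MeasurableSingletonClass A] [Fintype A]

theorem RewardBounded.ae_law_sum_le_one (hM : M.RewardBounded) :
    ∀ᵐ e ∂M.law π, ∑ h, (e h).2.2.1 ≤ 1 :=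
  M.ae_law_of_openLoop π (S := {e | ∑ h, (e h).2.2.1 ≤ 1})
    (measurableSet_le (Finset.measurable_sum _ fun i _ => by fun_prop) measurable_const)
    hM.sum_le_one

theorem RewardBounded.ae_trLaw_mem (hM : M.RewardBounded) {h : ℕ} (hh : h < M.H) :
    ∀ᵐ p ∂M.trLaw π h, p.2.2.1 ∈ Set.Icc (0 : ℝ) 1 := by
  have h1 : ∀ᵐ e ∂M.law π, (e ⟨h, hh⟩).2.2.1 ∈ Set.Icc (0 : ℝ) 1 := by
    filter_upwards [hM.ae_law_nonneg π, hM.ae_law_sum_le_one π] with e h0 hs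
    exact ⟨h0 _, (Finset.single_le_sum (f := fun i => (e i).2.2.1) (fun i _ => h0 i)
      (Finset.mem_univ _)).trans hs⟩
  rw [show M.trLaw π h = _ from (M.law_map_eval π ⟨h, hh⟩).symm]
  exact (ae_map_iff (measurable_eval _).aemeasurable (measurableSet_Icc.preimage (by fun_prop :
    Measurable fun p : Transition X A => p.2.2.1))).2 h1

theorem RewardBounded.integrable_reward (hM : M.RewardBounded) {h : ℕ} (hh : h < M.H) :
    Integrable (fun p => p.2.2.1) (M.trLaw π h) := by
  refine Integrable.of_bound (Measurable.aestronglyMeasurable (by fun_prop)) 1 ?_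
  filter_upwards [hM.ae_trLaw_mem π hh] with p hp
  rw [Real.norm_eq_abs, abs_of_nonneg hp.1]
  exact hp.2

theorem RewardBounded.integrable_reward_compProd (hM : M.RewardBounded) {h : ℕ} (hh : h < M.H) :
    Integrable (fun q => q.2) (M.saLaw π h ⊗ₘ M.R h) := by
  rw [← trLaw_map_reward]
  exact (integrable_map_measure (by fun_prop) (by fun_prop)).2 (hM.integrable_reward π hh)

theorem RewardBounded.integrable_meanReward (hM : M.RewardBounded) {h : ℕ} (hh : h < M.H) :
    Integrable (fun p : X × A => M.meanReward h p.1 p.2) (M.saLaw π h) :=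
  (hM.integrable_reward_compProd π hh).integral_measure_compProd

theorem RewardBounded.integral_meanReward (hM : M.RewardBounded) {h : ℕ} (hh : h < M.H) :
    ∫ p, M.meanReward h p.1 p.2 ∂M.saLaw π h = ∫ p, p.2.2.1 ∂M.trLaw π h := by
  have h1 := Measure.integral_compProd (hM.integrable_reward_compProd π hh)
  rw [← trLaw_map_reward, integral_map (by fun_prop) (by fun_prop)] at h1
  exact h1.symm

theorem RewardBounded.sum_integral_meanReward_le (hM : M.RewardBounded) :
    ∑ h ∈ Finset.range M.H, ∫ p, M.meanReward h p.1 p.2 ∂M.saLaw π h ≤ 1 := by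
  rw [Finset.sum_range]
  have h1 : ∀ h : Fin M.H, ∫ p, M.meanReward h p.1 p.2 ∂M.saLaw π h
      = ∫ e, (e h).2.2.1 ∂M.law π := by
    intro h
    rw [hM.integral_meanReward π h.2, ← law_map_eval,
      integral_map (measurable_eval h).aemeasurable
        (Measurable.aestronglyMeasurable (by fun_prop))]
  have h2 : ∀ h : Fin M.H, Integrable (fun e : M.Episode => (e h).2.2.1) (M.law π) := by
    intro h
    have := hM.integrable_reward π h.2
    rw [← law_map_eval] at this
    exact this.comp_measurable (by fun_prop)
  simp_rw [h1]
  rw [← integral_finsetSum _ fun h _ => h2 h]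
  calc ∫ e, ∑ h, (e h).2.2.1 ∂M.law π ≤ ∫ _, (1 : ℝ) ∂M.law π :=
        integral_mono_ae (integrable_finsetSum _ fun h _ => h2 h) (integrable_const _)
          (hM.ae_law_sum_le_one π)
    _ = 1 := by simp

/-- The value recursion is unrolled under the state law rather than pointwise: the reward bound
concerns episodes from the initial state and says nothing about the total reward from unreachable
states. Integrability is carried along in the induction, since a Bochner integral of a nonintegrable
function would be 0. -/
theorem RewardBounded.integral_valueToGo (hM : M.RewardBounded) (k : ℕ) (hk : k ≤ M.H) :
    Integrable (M.valueToGo π k) (M.stateLaw π (M.H - k)) ∧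
      ∫ x, M.valueToGo π k x ∂M.stateLaw π (M.H - k)
        = ∑ h ∈ Finset.Ico (M.H - k) M.H, ∫ p, M.meanReward h p.1 p.2 ∂M.saLaw π h := by
  induction k with
  | zero =>
    have h0 : M.valueToGo π 0 = fun _ => 0 := by funext x; rw [valueToGo]
    simp [h0]
  | succ k ih =>
    obtain ⟨n, hn⟩ : ∃ n, n = M.H - (k + 1) := ⟨_, rfl⟩
    have hn1 : M.H - k = n + 1 := by omega
    have hnH : n < M.H := by omega
    obtain ⟨ih1, ih2⟩ := ih (by omega)
    rw [hn1] at ih1 ih2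
    have hI : Integrable (fun q : (X × A) × X => M.valueToGo π k q.2)
        (M.saLaw π n ⊗ₘ M.P n) := by
      rw [stateLaw_succ'] at ih1
      exact ih1.comp_measurable measurable_snd
    have hI' : Integrable (fun p : X × A => ∫ y, M.valueToGo π k y ∂M.P n p) (M.saLaw π n) :=
      hI.integral_measure_compProd
    have hV : M.valueToGo π (k + 1) = fun x => ∫ a, (M.meanReward n x a
        + ∫ y, M.valueToGo π k y ∂M.P n (x, a)) ∂π.ker n x := by
      funext x; rw [valueToGo, ← hn]
    have hg : Integrable (fun p : X × A => M.meanReward n p.1 p.2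
        + ∫ y, M.valueToGo π k y ∂M.P n p) (M.stateLaw π n ⊗ₘ π.ker n) :=
      (hM.integrable_meanReward π hnH).add hI'
    rw [← hn, hV]
    refine ⟨hg.integral_measure_compProd, ?_⟩
    rw [← Measure.integral_compProd hg, Finset.sum_eq_sum_Ico_succ_bot hnH, ← ih2]
    change ∫ p, (_ + _) ∂M.saLaw π n = _
    rw [integral_add (hM.integrable_meanReward π hnH) hI', ← Measure.integral_compProd hI,
      stateLaw_succ']
    congr 1
    rw [stateLaw_succ'] at ih1
    exact (integral_map measurable_snd.aemeasurable ih1.aestronglyMeasurable).symm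

theorem RewardBounded.ret_eq (hM : M.RewardBounded) :
    M.ret π = ∑ h ∈ Finset.range M.H, ∫ p, M.meanReward h p.1 p.2 ∂M.saLaw π h := by
  have h1 := hM.integral_valueToGo π M.H le_rfl
  rw [Nat.sub_self] at h1
  rw [ret, V, Nat.sub_zero, Finset.range_eq_Ico, ← h1.2, stateLaw_zero,
    integral_dirac' _ _ (stronglyMeasurable_valueToGo π _)]

theorem RewardBounded.ret_nonneg (hM : M.RewardBounded) : 0 ≤ M.ret π := by
  rw [hM.ret_eq]
  exact Finset.sum_nonneg fun h hh => integral_nonneg fun p =>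
    hM.meanReward_nonneg (Finset.mem_range.1 hh) _ _

theorem RewardBounded.ret_le_one (hM : M.RewardBounded) : M.ret π ≤ 1 := by
  rw [hM.ret_eq]
  exact hM.sum_integral_meanReward_le π

theorem RewardBounded.ret_le_optRet (hM : M.RewardBounded) : M.ret π ≤ M.optRet :=
  le_ciSup (f := fun π : Policy X A => M.ret π) ⟨1, by rintro _ ⟨π, rfl⟩; exact hM.ret_le_one π⟩ π

theorem RewardBounded.optRet_le_one (hM : M.RewardBounded) : M.optRet ≤ 1 :=
  Real.iSup_le (fun π => hM.ret_le_one π) zero_le_one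

end MDP
end MyopicRL

/-! ### Cost of exploration and the policy loss decomposition -/

namespace MyopicRL

variable {X : Type u} {A : Type v} [MeasurableSpace X] [MeasurableSpace A]

namespace MDP

variable {M : MDP X A}

theorem smul_saLaw_le_of_stateLaw {π π' : Policy X A} {c : ENNReal}
    (hc : ∀ h x, c • π.ker h x ≤ π'.ker h x) (n : ℕ)
    (h0 : c ^ n • M.stateLaw π n ≤ M.stateLaw π' n) :
    c ^ (n + 1) • M.saLaw π n ≤ M.saLaw π' n := by
  refine Measure.le_intro fun s hs _ => ?_
  rw [Measure.smul_apply, saLaw, saLaw, Measure.compProd_apply hs, Measure.compProd_apply hs,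
    smul_eq_mul, pow_succ, mul_assoc,
    ← lintegral_const_mul _ (Kernel.measurable_kernel_prodMk_left hs), ← smul_eq_mul,
    ← lintegral_smul_measure]
  exact lintegral_mono' h0 fun x => hc n x _

/-- Domination of the action kernels multiplies along the episode: the state at step `n` has seen
`n` actions, and the pair of state and action one more. -/
theorem smul_stateLaw_le {π π' : Policy X A} {c : ENNReal}
    (hc : ∀ h x, c • π.ker h x ≤ π'.ker h x) (n : ℕ) :
    c ^ n • M.stateLaw π n ≤ M.stateLaw π' n := by
  induction n with
  | zero => simp [stateLaw_zero]
  | succ n ih =>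
    have h1 := smul_saLaw_le_of_stateLaw hc n ih
    refine Measure.le_intro fun s hs _ => ?_
    rw [stateLaw_succ', stateLaw_succ', Measure.smul_apply, Measure.map_apply measurable_snd hs,
      Measure.map_apply measurable_snd hs, Measure.compProd_apply (measurable_snd hs),
      Measure.compProd_apply (measurable_snd hs), ← lintegral_smul_measure]
    exact lintegral_mono' h1 le_rfl

variable [MeasurableSingletonClass A] [Fintype A]

theorem RewardBounded.pow_mul_ret_le (hM : M.RewardBounded) {π π' : Policy X A} {c : ℝ}
    (hc0 : 0 ≤ c) (hc1 : c ≤ 1) (hc : ∀ h x, ENNReal.ofReal c • π.ker h x ≤ π'.ker h x) :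
    c ^ M.H * M.ret π ≤ M.ret π' := by
  rw [hM.ret_eq, hM.ret_eq, Finset.mul_sum]
  refine Finset.sum_le_sum fun h hh => ?_
  have hh := Finset.mem_range.1 hh
  have hnn : ∀ p : X × A, 0 ≤ M.meanReward h p.1 p.2 := fun p => hM.meanReward_nonneg hh _ _
  have h1 := integral_mono_measure (smul_saLaw_le_of_stateLaw hc h (smul_stateLaw_le (M := M) hc h))
    (Filter.Eventually.of_forall hnn) (hM.integrable_meanReward π' hh)
  rw [integral_smul_measure, ENNReal.toReal_pow, ENNReal.toReal_ofReal hc0, smul_eq_mul] at h1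
  refine le_trans (mul_le_mul_of_nonneg_right ?_ (integral_nonneg hnn)) h1
  exact pow_le_pow_of_le_one hc0 hc1 hh

/-- The exploration kernel is at least (1 - ε) times the greedy one, so it keeps a fraction (1 -
ε)^H ≥ 1 - εH (Bernoulli) of the greedy return, which is at most 1. -/
theorem RewardBounded.ret_sub_le_ret_epsGreedy [Nonempty A] (hM : M.RewardBounded)
    (ε : ℝ) (hε : ε ∈ Set.Icc (0 : ℝ) 1) (act : ℕ → X → A) (hact : ∀ h, Measurable (act h)) :
    M.ret (Policy.ofAct act hact) - ε * M.H ≤ M.ret (Policy.epsGreedy ε hε act hact) := by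
  have h1 := hM.pow_mul_ret_le (π := Policy.ofAct act hact) (π' := Policy.epsGreedy ε hε act hact)
    (c := 1 - ε) (by linarith [hε.2]) (by linarith [hε.1]) fun h x => by
      change _ ≤ ENNReal.ofReal (1 - ε) • Measure.dirac (act h x)
        + ENNReal.ofReal (ε / Fintype.card A) • Measure.count
      rw [Policy.ofAct, Kernel.deterministic_apply]
      exact Measure.le_add_right le_rfl
  have h2 := one_add_mul_le_pow (a := -ε) (by linarith [hε.2]) M.H
  have h3 := hM.ret_nonneg (Policy.ofAct act hact)
  have h4 := hM.ret_le_one (Policy.ofAct act hact)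
  have h5 : (1 - ε * M.H) * M.ret (Policy.ofAct act hact)
      ≤ (1 - ε) ^ M.H * M.ret (Policy.ofAct act hact) :=
    mul_le_mul_of_nonneg_right (by rw [sub_eq_add_neg 1 ε]; linarith) h3
  have h6 : ε * M.H * M.ret (Policy.ofAct act hact) ≤ ε * M.H :=
    mul_le_of_le_one_right (mul_nonneg hε.1 (Nat.cast_nonneg _)) h4
  linarith

end MDP

variable [MeasurableSingletonClass A] [Fintype A]

/-- The value of the best action. -/
abbrev maxVal (f : X → A → ℝ) (x : X) : ℝ := ⨆ a, f x a

omit [MeasurableSpace X] [MeasurableSpace A] [MeasurableSingletonClass A] in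
theorem le_maxVal (f : X → A → ℝ) (x : X) (a : A) : f x a ≤ maxVal f x :=
  le_ciSup (Set.finite_range _).bddAbove a

omit [MeasurableSingletonClass A] in
theorem measurable_maxVal {f : X → A → ℝ} (hf : Measurable fun p : X × A => f p.1 p.2) :
    Measurable (maxVal f) :=
  Measurable.iSup fun a => hf.comp (by fun_prop : Measurable fun x : X => (x, a))

omit [MeasurableSpace X] [MeasurableSpace A] [MeasurableSingletonClass A] in
theorem maxVal_mem_Icc [Nonempty A] {f : X → A → ℝ} (hf : ∀ x a, f x a ∈ Set.Icc (0 : ℝ) 1)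
    (x : X) : maxVal f x ∈ Set.Icc (0 : ℝ) 1 :=
  ⟨(hf x (Classical.arbitrary A)).1.trans (le_maxVal f x _), ciSup_le fun a => (hf x a).2⟩

theorem integrable_of_mem_Icc {S : Type*} [MeasurableSpace S] {μ : Measure S} [IsFiniteMeasure μ]
    {f : S → ℝ} (hf : Measurable f) (hb : ∀ s, f s ∈ Set.Icc (0 : ℝ) 1) : Integrable f μ :=
  Integrable.of_bound hf.aestronglyMeasurable 1 (Filter.Eventually.of_forall fun s => by
    rw [Real.norm_eq_abs, abs_of_nonneg (hb s).1]; exact (hb s).2)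

namespace MDP

variable {M : MDP X A} [Nonempty A]

theorem RewardBounded.integrable_bellman (hM : M.RewardBounded) (π : Policy X A) {h : ℕ}
    (hh : h < M.H) {f : X → A → ℝ} (hf : Measurable fun p : X × A => f p.1 p.2)
    (hb : ∀ x a, f x a ∈ Set.Icc (0 : ℝ) 1) :
    Integrable (fun p : X × A => M.bellman h f p.1 p.2) (M.saLaw π h) ∧
      ∫ p, M.bellman h f p.1 p.2 ∂M.saLaw π h
        = ∫ p, M.meanReward h p.1 p.2 ∂M.saLaw π h + ∫ x, maxVal f x ∂M.stateLaw π (h + 1) := by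
  have h1 : Integrable (maxVal f) (M.stateLaw π (h + 1)) :=
    integrable_of_mem_Icc (measurable_maxVal hf) (maxVal_mem_Icc hb)
  rw [stateLaw_succ'] at h1 ⊢
  have h2 : Integrable (fun q : (X × A) × X => maxVal f q.2) (M.saLaw π h ⊗ₘ M.P h) :=
    h1.comp_measurable measurable_snd
  have h3 := hM.integrable_meanReward π hh
  refine ⟨h3.add h2.integral_measure_compProd, ?_⟩
  rw [integral_map measurable_snd.aemeasurable h1.aestronglyMeasurable,
    Measure.integral_compProd h2]
  exact integral_add h3 h2.integral_measure_compProd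

omit [Fintype A] [Nonempty A] in
theorem integral_saLaw_ofAct {act : ℕ → X → A} (hact : ∀ h, Measurable (act h)) (n : ℕ)
    {f : X × A → ℝ} (hint : Integrable f (M.saLaw (Policy.ofAct act hact) n)) :
    ∫ p, f p ∂M.saLaw (Policy.ofAct act hact) n
      = ∫ x, f (x, act n x) ∂M.stateLaw (Policy.ofAct act hact) n := by
  rw [saLaw] at hint ⊢
  rw [Measure.integral_compProd hint]
  refine integral_congr_ae (Filter.Eventually.of_forall fun x => ?_)
  change ∫ a, f (x, a) ∂Kernel.deterministic (act n) (hact n) x = _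
  rw [Kernel.deterministic_apply, integral_dirac]

omit [MeasurableSingletonClass A] in
theorem integral_saLaw_le_maxVal (π : Policy X A) (n : ℕ) {f : X → A → ℝ}
    (hf : Measurable fun p : X × A => f p.1 p.2) (hb : ∀ x a, f x a ∈ Set.Icc (0 : ℝ) 1) :
    ∫ p, f p.1 p.2 ∂M.saLaw π n ≤ ∫ x, maxVal f x ∂M.stateLaw π n := by
  have h1 : M.stateLaw π n = (M.saLaw π n).map Prod.fst := (Measure.fst_compProd _ _).symm
  rw [h1, integral_map measurable_fst.aemeasurable (measurable_maxVal hf).aestronglyMeasurable]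
  exact integral_mono (integrable_of_mem_Icc hf fun p => hb _ _)
    (integrable_of_mem_Icc ((measurable_maxVal hf).comp measurable_fst) fun p =>
      maxVal_mem_Icc hb _) fun p => le_maxVal f p.1 p.2

end MDP

variable {M : MDP X A} {F : FnClass M} [Nonempty A]

theorem FnClass.integral_residual (hM : M.RewardBounded) {f : ValueFn X A} (hf : f ∈ F.fns)
    (π : Policy X A) {h : ℕ} (hh : h < M.H) :
    ∫ p, M.residual h f p ∂M.saLaw π h
      = ∫ p, f h p.1 p.2 ∂M.saLaw π h - ∫ p, M.meanReward h p.1 p.2 ∂M.saLaw π h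
        - ∫ x, maxVal (f (h + 1)) x ∂M.stateLaw π (h + 1) := by
  obtain ⟨h1, h2⟩ := hM.integrable_bellman π hh (F.measurable _ _ (hf (h + 1)))
    (F.mem_Icc _ _ (hf (h + 1)))
  have h3 : Integrable (fun p : X × A => f h p.1 p.2) (M.saLaw π h) :=
    integrable_of_mem_Icc (F.measurable _ _ (hf h)) fun p => F.mem_Icc _ _ (hf h) _ _
  rw [show M.residual h f = fun p => f h p.1 p.2 - M.bellman h (f (h + 1)) p.1 p.2 from rfl,
    integral_sub h3 h1, h2]
  ring

/-- The policy loss decomposition, for the comparison of a greedy policy with any policy. -/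
theorem Greedy.ret_sub_ret_le (hM : M.RewardBounded) (G : Greedy F) {f : ValueFn X A}
    (hf : f ∈ F.fns) (π' : Policy X A) :
    M.ret π' - M.ret (G.policy f)
      ≤ ∑ h : Fin M.H, (∫ p, M.residual h f p ∂M.occ (G.policy f) h
          - ∫ p, M.residual h f p ∂M.occ π' h) := by
  simp_rw [MDP.occ_eq]
  rw [← Finset.sum_range (fun h => (∫ p, M.residual h f p ∂M.saLaw (G.policy f) h
          - ∫ p, M.residual h f p ∂M.saLaw π' h)), Finset.sum_sub_distrib]
  -- The mean residuals telescope, because the maximum of f_{h+1} inside the Bellman operator is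
  -- evaluated under the next state law and f vanishes after the last step. The remaining sum of f_h
  -- - max f_h is zero for the greedy policy and nonpositive for any other, and the initial value
  -- cancels in the difference. No optimism is involved.
  have hstep : ∀ π : Policy X A, ∑ h ∈ Finset.range M.H, ∫ p, M.residual h f p ∂M.saLaw π h
      = ∑ h ∈ Finset.range M.H, (∫ p, f h p.1 p.2 ∂M.saLaw π h
        - ∫ x, maxVal (f h) x ∂M.stateLaw π h) + maxVal (f 0) M.xInit - M.ret π := by
    intro π
    rw [hM.ret_eq, Finset.sum_congr rfl fun h hh =>
      FnClass.integral_residual hM hf π (Finset.mem_range.1 hh)]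
    have htel := Finset.sum_range_sub' (fun h => ∫ x, maxVal (f h) x ∂M.stateLaw π h) M.H
    have hH : f M.H = 0 := by
      have := hf M.H
      rwa [F.terminal _ le_rfl] at this
    have h0 : ∫ x, maxVal (f M.H) x ∂M.stateLaw π M.H = 0 := by
      simp [maxVal, hH]
    rw [h0, MDP.stateLaw_zero, integral_dirac' _ _
      (measurable_maxVal (F.measurable _ _ (hf 0))).stronglyMeasurable, sub_zero] at htel
    rw [← htel, ← sub_eq_zero]
    simp only [Finset.sum_sub_distrib]
    ring
  have h1 : ∑ h ∈ Finset.range M.H, (∫ p, f h p.1 p.2 ∂M.saLaw π' h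
        - ∫ x, maxVal (f h) x ∂M.stateLaw π' h) ≤ 0 :=
    Finset.sum_nonpos fun h _ => sub_nonpos.2
      (MDP.integral_saLaw_le_maxVal π' h (F.measurable _ _ (hf h)) (F.mem_Icc _ _ (hf h)))
  have h2 : ∑ h ∈ Finset.range M.H, (∫ p, f h p.1 p.2 ∂M.saLaw (G.policy f) h
        - ∫ x, maxVal (f h) x ∂M.stateLaw (G.policy f) h) = 0 := by
    refine Finset.sum_eq_zero fun h hh => sub_eq_zero.2 ?_
    rw [Greedy.policy, MDP.integral_saLaw_ofAct _ _
      (integrable_of_mem_Icc (F.measurable _ _ (hf h)) fun p => F.mem_Icc _ _ (hf h) _ _)]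
    refine integral_congr_ae (Filter.Eventually.of_forall fun x => ?_)
    exact le_antisymm (le_maxVal _ _ _)
      (ciSup_le fun a => G.greedy f hf h (Finset.mem_range.1 hh) x a)
  rw [hstep, hstep, h2]
  linarith

end MyopicRL

/-! ### Conditional expectations and exponential supermartingales -/

namespace MyopicRL

section Probability

/-- If the conditional law of `e` given `m` is `ν`, then conditional expectations of bounded
functions of `e` are integrals with respect to `ν`. -/
theorem condExp_comp_ae_eq_integral {Ω E : Type*} [MeasurableSpace E] {m mΩ : MeasurableSpace Ω}
    {μ : Measure Ω} [IsProbabilityMeasure μ] {e : Ω → E} (he : Measurable e) {ν : Ω → Measure E}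
    [hν : ∀ ω, IsProbabilityMeasure (ν ω)]
    (hlaw : ∀ S, MeasurableSet S →
      μ[(e ⁻¹' S).indicator (fun _ => (1 : ℝ)) | m] =ᵐ[μ] fun ω => (ν ω).real S)
    {φ : E → ℝ} (hφ : Measurable φ) {B : ℝ} (hB : ∀ p, |φ p| ≤ B) :
    μ[φ ∘ e | m] =ᵐ[μ] fun ω => ∫ p, φ p ∂ν ω := by
  have hint : ∀ (ρ : Measure E) [IsProbabilityMeasure ρ], Integrable φ ρ := fun ρ _ =>
    Integrable.of_bound hφ.aestronglyMeasurable B (Filter.Eventually.of_forall hB)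
  have hintΩ : Integrable (φ ∘ e) μ :=
    Integrable.of_bound (hφ.comp he).aestronglyMeasurable B
      (Filter.Eventually.of_forall fun ω => hB _)
  have key : ∀ n : ℕ, ∀ᵐ ω ∂μ, |(μ[φ ∘ e | m]) ω - ∫ p, φ p ∂ν ω| ≤ 2 / ((n : ℝ) + 1) := by
    intro n
    have hn : (0 : ℝ) < (n : ℝ) + 1 := by positivity
    -- Discretize φ to multiples of 1/(n+1). Boundedness leaves finitely many level sets, to which
    -- the conditional law applies; rounding costs 1/(n+1) in the conditional expectation and again
    -- in the integral. Measurability of ν is not needed.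
    let I : Finset ℤ := Finset.Icc ⌊-(((n : ℝ) + 1) * B)⌋ ⌊((n : ℝ) + 1) * B⌋
    let S : ℤ → Set E := fun k => {p | ⌊((n : ℝ) + 1) * φ p⌋ = k}
    have hS : ∀ k, MeasurableSet (S k) := fun k =>
      (Int.measurable_floor.comp (hφ.const_mul _)) (measurableSet_singleton k)
    let ψ : E → ℝ := fun p => ∑ k ∈ I, ((k : ℝ) / ((n : ℝ) + 1)) * (S k).indicator (fun _ => 1) p
    have hψ : ∀ p, ψ p = (⌊((n : ℝ) + 1) * φ p⌋ : ℝ) / ((n : ℝ) + 1) := by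
      intro p
      have hmem : ⌊((n : ℝ) + 1) * φ p⌋ ∈ I := by
        have := abs_le.1 (hB p)
        refine Finset.mem_Icc.2 ⟨Int.floor_le_floor ?_, Int.floor_le_floor ?_⟩
        · rw [← mul_neg]; exact mul_le_mul_of_nonneg_left this.1 hn.le
        · exact mul_le_mul_of_nonneg_left this.2 hn.le
      change ∑ k ∈ I, _ = _
      rw [Finset.sum_eq_single_of_mem _ hmem]
      · simp [S]
      · intro k _ hk
        have : p ∉ S k := fun h => hk (h.symm)
        simp [this]
    have hclose : ∀ p, |φ p - ψ p| ≤ 1 / ((n : ℝ) + 1) := by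
      intro p
      rw [hψ, show φ p - (⌊((n : ℝ) + 1) * φ p⌋ : ℝ) / ((n : ℝ) + 1)
        = (((n : ℝ) + 1) * φ p - ⌊((n : ℝ) + 1) * φ p⌋) / ((n : ℝ) + 1) by field_simp,
        abs_div, abs_of_pos hn, abs_of_nonneg (sub_nonneg.2 (Int.floor_le _))]
      gcongr
      linarith [Int.lt_floor_add_one (((n : ℝ) + 1) * φ p)]
    have hψm : Measurable ψ :=
      Finset.measurable_sum _ fun k _ => (measurable_const.indicator (hS k)).const_mul _
    have hψb : ∀ p, |ψ p| ≤ B + 1 / ((n : ℝ) + 1) := by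
      intro p
      have h1 := hclose p
      have h2 := hB p
      rw [abs_le] at *
      constructor <;> linarith
    have hψint : ∀ (ρ : Measure E) [IsProbabilityMeasure ρ], Integrable ψ ρ := fun ρ _ =>
      Integrable.of_bound hψm.aestronglyMeasurable _ (Filter.Eventually.of_forall hψb)
    have hψΩ : Integrable (ψ ∘ e) μ :=
      Integrable.of_bound (hψm.comp he).aestronglyMeasurable _
        (Filter.Eventually.of_forall fun ω => hψb _)
    have hψc : μ[ψ ∘ e | m] =ᵐ[μ] fun ω => ∫ p, ψ p ∂ν ω := by
      have h1 : ψ ∘ e = ∑ k ∈ I, ((k : ℝ) / ((n : ℝ) + 1)) •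
          (e ⁻¹' S k).indicator (fun _ => (1 : ℝ)) := by
        funext ω
        simp only [Function.comp, ψ, Finset.sum_apply, Pi.smul_apply, smul_eq_mul]
        rfl
      rw [h1]
      have h2 := condExp_finsetSum (μ := μ) (s := I)
        (f := fun k : ℤ => ((k : ℝ) / ((n : ℝ) + 1)) •
          (e ⁻¹' S k).indicator (fun _ => (1 : ℝ)))
        (fun k _ => ((integrable_const (1 : ℝ)).indicator (he (hS k))).smul _) m
      refine h2.trans ?_
      have h3 : ∀ᵐ ω ∂μ, ∀ k ∈ I, (μ[((k : ℝ) / ((n : ℝ) + 1)) •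
          (e ⁻¹' S k).indicator (fun _ => (1 : ℝ)) | m]) ω
            = ((k : ℝ) / ((n : ℝ) + 1)) * (ν ω).real (S k) := by
        rw [Filter.eventually_all_finset]
        intro k _
        filter_upwards [condExp_smul (μ := μ) ((k : ℝ) / ((n : ℝ) + 1))
          ((e ⁻¹' S k).indicator (fun _ => (1 : ℝ))) m, hlaw _ (hS k)] with ω h4 h5
        rw [h4, Pi.smul_apply, smul_eq_mul, h5]
      filter_upwards [h3] with ω hω
      rw [Finset.sum_apply, Finset.sum_congr rfl hω]
      change _ = ∫ p, ∑ k ∈ I, _ ∂ν ω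
      rw [integral_finsetSum _ fun k _ => ((integrable_const (1 : ℝ)).indicator (hS k)).const_mul _]
      refine Finset.sum_congr rfl fun k _ => ?_
      rw [integral_const_mul, integral_indicator_const _ (hS k), smul_eq_mul, mul_one]
    have hbd := ae_bdd_abs_condExp_of_ae_bdd_abs (μ := μ) (m := m) (R := 1 / ((n : ℝ) + 1))
      (f := φ ∘ e - ψ ∘ e) (Filter.Eventually.of_forall fun ω => hclose (e ω))
    filter_upwards [hψc, hbd, condExp_sub hintΩ hψΩ m] with ω h1 h2 h3
    rw [h3, Pi.sub_apply, h1] at h2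
    have h4 : |∫ p, φ p ∂ν ω - ∫ p, ψ p ∂ν ω| ≤ 1 / ((n : ℝ) + 1) := by
      rw [← integral_sub (hint _) (hψint _)]
      have := norm_integral_le_of_norm_le_const (μ := ν ω) (f := fun p => φ p - ψ p)
        (Filter.Eventually.of_forall hclose)
      simpa using this
    change |_| ≤ 1 / ((n : ℝ) + 1) at h2
    rw [abs_le] at *
    have h5 : 2 / ((n : ℝ) + 1) = 1 / ((n : ℝ) + 1) + 1 / ((n : ℝ) + 1) := by ring
    rw [h5]
    constructor <;> linarith
  filter_upwards [ae_all_iff.2 key] with ω hω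
  have hlim : Filter.Tendsto (fun n : ℕ => 2 / ((n : ℝ) + 1)) Filter.atTop (nhds 0) := by
    have := (tendsto_one_div_add_atTop_nhds_zero_nat (𝕜 := ℝ)).const_mul 2
    simpa [div_eq_mul_inv] using this
  have := ge_of_tendsto' hlim hω
  exact sub_eq_zero.1 (abs_nonpos_iff.1 this)

variable {Ω : Type*} {mΩ : MeasurableSpace Ω} {μ : Measure Ω} [IsProbabilityMeasure μ]

/-- The integral of an exponential supermartingale is at most `1`. -/
theorem integral_exp_sum_le_one {ℋ : Filtration ℕ mΩ} {Y q : ℕ → Ω → ℝ} {B : ℝ}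
    (hY : ∀ s, Measurable[ℋ (s + 1)] (Y s)) (hq : ∀ s, Measurable[ℋ s] (q s))
    (hYb : ∀ s, ∀ᵐ ω ∂μ, |Y s ω| ≤ B) (hqb : ∀ s, ∀ᵐ ω ∂μ, |q s ω| ≤ B)
    (hc : ∀ s, μ[fun ω => Real.exp (-Y s ω) | ℋ s] ≤ᵐ[μ] fun ω => Real.exp (-q s ω)) (t : ℕ) :
    Integrable (fun ω => Real.exp (∑ s ∈ Finset.range t, (q s ω - Y s ω))) μ ∧
      ∫ ω, Real.exp (∑ s ∈ Finset.range t, (q s ω - Y s ω)) ∂μ ≤ 1 := by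
  have hmeas : ∀ t, Measurable[ℋ t] fun ω => ∑ s ∈ Finset.range t, (q s ω - Y s ω) := fun t =>
    Finset.measurable_sum _ fun s hs => by
      have hs := Finset.mem_range.1 hs
      exact ((hq s).mono (ℋ.mono hs.le) le_rfl).sub ((hY s).mono (ℋ.mono hs) le_rfl)
  have hbd : ∀ t : ℕ, ∀ᵐ ω ∂μ, ∑ s ∈ Finset.range t, (q s ω - Y s ω) ≤ t * (2 * B) := by
    intro t
    filter_upwards [ae_all_iff.2 hYb, ae_all_iff.2 hqb] with ω h1 h2
    calc ∑ s ∈ Finset.range t, (q s ω - Y s ω) ≤ ∑ s ∈ Finset.range t, 2 * B :=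
          Finset.sum_le_sum fun s _ => by
            linarith [(abs_le.1 (h1 s)).1, (abs_le.1 (h2 s)).2]
      _ = _ := by simp
  have hexp : ∀ f : Ω → ℝ, Measurable f → ∀ C : ℝ, (∀ᵐ ω ∂μ, f ω ≤ C) →
      Integrable (fun ω => Real.exp (f ω)) μ := by
    intro f hf C hC
    refine Integrable.of_bound hf.exp.aestronglyMeasurable (Real.exp C) ?_
    filter_upwards [hC] with ω hω
    rw [Real.norm_eq_abs, Real.abs_exp]
    exact Real.exp_le_exp.2 hω
  have hint : ∀ t, Integrable (fun ω => Real.exp (∑ s ∈ Finset.range t, (q s ω - Y s ω))) μ :=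
    fun t => hexp _ ((hmeas t).mono (ℋ.le t) le_rfl) _ (hbd t)
  refine ⟨hint t, ?_⟩
  induction t with
  | zero => simp
  | succ t ih =>
    refine le_trans ?_ ih
    -- The predictable term `q t` joins the past in `W`, which can be pulled out of the conditional
    -- expectation; `hc` then cancels it.
    let W : Ω → ℝ := fun ω => Real.exp (∑ s ∈ Finset.range t, (q s ω - Y s ω) + q t ω)
    let Z : Ω → ℝ := fun ω => Real.exp (-Y t ω)
    have hW : StronglyMeasurable[ℋ t] W := ((hmeas t).add (hq t)).exp.stronglyMeasurable
    have hWZ : (fun ω => Real.exp (∑ s ∈ Finset.range (t + 1), (q s ω - Y s ω))) = W * Z := by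
      funext ω
      simp only [W, Z, Pi.mul_apply, ← Real.exp_add, Finset.sum_range_succ]
      congr 1
      ring
    have hZint : Integrable Z μ := by
      refine hexp _ ((hY t).mono (ℋ.le _) le_rfl).neg B ?_
      filter_upwards [hYb t] with ω h1
      linarith [(abs_le.1 h1).1]
    have hWZint : Integrable (W * Z) μ := hWZ ▸ hint (t + 1)
    have hpull := condExp_mul_of_stronglyMeasurable_left hW hWZint hZint
    rw [hWZ, ← integral_condExp (ℋ.le t), integral_congr_ae hpull]
    refine integral_mono_ae (integrable_condExp.congr hpull) (hint t) ?_
    filter_upwards [hc t] with ω hω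
    calc W ω * (μ[Z | ℋ t]) ω ≤ W ω * Real.exp (-q t ω) :=
          mul_le_mul_of_nonneg_left hω (Real.exp_pos _).le
      _ = _ := by
          simp only [W, ← Real.exp_add]
          congr 1
          ring

/-- Markov's inequality for the supermartingale at level 1/δ. -/
theorem measure_log_lt_sum_le {ℋ : Filtration ℕ mΩ} {Y q : ℕ → Ω → ℝ} {B : ℝ}
    (hY : ∀ s, Measurable[ℋ (s + 1)] (Y s)) (hq : ∀ s, Measurable[ℋ s] (q s))
    (hYb : ∀ s, ∀ᵐ ω ∂μ, |Y s ω| ≤ B) (hqb : ∀ s, ∀ᵐ ω ∂μ, |q s ω| ≤ B)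
    (hc : ∀ s, μ[fun ω => Real.exp (-Y s ω) | ℋ s] ≤ᵐ[μ] fun ω => Real.exp (-q s ω)) (t : ℕ)
    {δ : ℝ} (hδ : 0 < δ) :
    μ {ω | Real.log (1 / δ) < ∑ s ∈ Finset.range t, (q s ω - Y s ω)} ≤ ENNReal.ofReal δ := by
  obtain ⟨h1, h2⟩ := integral_exp_sum_le_one hY hq hYb hqb hc t
  have h3 := mul_meas_ge_le_integral_of_nonneg
    (Filter.Eventually.of_forall fun ω => (Real.exp_pos _).le) h1 (1 / δ)
  have h4 : μ.real {ω | 1 / δ ≤ Real.exp (∑ s ∈ Finset.range t, (q s ω - Y s ω))} ≤ δ := by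
    have h5 := h3.trans h2
    rw [one_div, inv_mul_le_iff₀ hδ] at h5
    simpa using h5
  have h6 : μ {ω | 1 / δ ≤ Real.exp (∑ s ∈ Finset.range t, (q s ω - Y s ω))}
      ≤ ENNReal.ofReal δ := by
    rw [← ofReal_measureReal]
    exact ENNReal.ofReal_le_ofReal h4
  refine (measure_mono fun ω hω => ?_).trans h6
  change 1 / δ ≤ _
  rw [← Real.exp_log (one_div_pos.2 hδ)]
  exact Real.exp_le_exp.2 (le_of_lt hω)

end Probability

end MyopicRL

/-! ### Excess loss of the regression -/

namespace MyopicRL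

variable {X : Type u} {A : Type v} [MeasurableSpace X] [MeasurableSpace A]

/-- The truncation of a reward to `[0, 1]`. -/
def clip (r : ℝ) : ℝ := max 0 (min r 1)

theorem clip_mem_Icc (r : ℝ) : clip r ∈ Set.Icc (0 : ℝ) 1 :=
  ⟨le_max_left _ _, max_le zero_le_one (min_le_right _ _)⟩

theorem clip_of_mem {r : ℝ} (hr : r ∈ Set.Icc (0 : ℝ) 1) : clip r = r := by
  rw [clip, min_eq_left hr.2, max_eq_right hr.1]

theorem measurable_clip : Measurable clip :=
  measurable_const.max (measurable_id.min measurable_const)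

/-- The excess of the squared loss of `g` over that of `b`, for the regression target `r + m x'`. -/
def excessLoss (g b : X → A → ℝ) (m : X → ℝ) (p : Transition X A) : ℝ :=
  (g p.1 p.2.1 - clip p.2.2.1 - m p.2.2.2) ^ 2 - (b p.1 p.2.1 - clip p.2.2.1 - m p.2.2.2) ^ 2

theorem measurable_excessLoss {g b : X → A → ℝ} {m : X → ℝ}
    (hg : Measurable fun p : X × A => g p.1 p.2) (hb : Measurable fun p : X × A => b p.1 p.2)
    (hm : Measurable m) : Measurable (excessLoss g b m) := by
  have h1 : Measurable fun p : Transition X A => g p.1 p.2.1 :=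
    hg.comp (by fun_prop : Measurable fun p : Transition X A => (p.1, p.2.1))
  have h2 : Measurable fun p : Transition X A => b p.1 p.2.1 :=
    hb.comp (by fun_prop : Measurable fun p : Transition X A => (p.1, p.2.1))
  have h3 : Measurable fun p : Transition X A => clip p.2.2.1 :=
    measurable_clip.comp (by fun_prop)
  have h4 : Measurable fun p : Transition X A => m p.2.2.2 := hm.comp (by fun_prop)
  exact (((h1.sub h3).sub h4).pow_const 2).sub (((h2.sub h3).sub h4).pow_const 2)

omit [MeasurableSpace X] [MeasurableSpace A] in
theorem abs_excessLoss_le {g b : X → A → ℝ} {m : X → ℝ} (hg : ∀ x a, g x a ∈ Set.Icc (0 : ℝ) 1)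
    (hb : ∀ x a, b x a ∈ Set.Icc (0 : ℝ) 1) (hm : ∀ x, m x ∈ Set.Icc (0 : ℝ) 1)
    (p : Transition X A) : |excessLoss g b m p| ≤ 4 := by
  have hg := hg p.1 p.2.1
  have hb := hb p.1 p.2.1
  have hm := hm p.2.2.2
  have hr := clip_mem_Icc p.2.2.1
  have h1 : (g p.1 p.2.1 - clip p.2.2.1 - m p.2.2.2) ^ 2 ≤ 2 ^ 2 :=
    sq_le_sq' (by linarith [hg.1, hm.2, hr.2]) (by linarith [hg.2, hm.1, hr.1])
  have h2 : (b p.1 p.2.1 - clip p.2.2.1 - m p.2.2.2) ^ 2 ≤ 2 ^ 2 :=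
    sq_le_sq' (by linarith [hb.1, hm.2, hr.2]) (by linarith [hb.2, hm.1, hr.1])
  rw [excessLoss, abs_le]
  constructor <;> nlinarith [sq_nonneg (g p.1 p.2.1 - clip p.2.2.1 - m p.2.2.2),
    sq_nonneg (b p.1 p.2.1 - clip p.2.2.1 - m p.2.2.2)]

omit [MeasurableSpace X] [MeasurableSpace A] in
-- The excess loss factors as (g - b)(g + b - 2r - 2m) with second factor at most 4 in absolute
-- value. For |z| ≤ 1, exp z ≤ 1 + z + z², and here z² ≤ 16(g - b)²/32² = (g - b)²/64. Clipping the
-- reward makes this hold at every transition and not only almost surely.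
theorem exp_neg_excessLoss_le {g b : X → A → ℝ} {m : X → ℝ}
    (hg : ∀ x a, g x a ∈ Set.Icc (0 : ℝ) 1) (hb : ∀ x a, b x a ∈ Set.Icc (0 : ℝ) 1)
    (hm : ∀ x, m x ∈ Set.Icc (0 : ℝ) 1) (p : Transition X A) :
    Real.exp (-(excessLoss g b m p / 32)) ≤ 1 - excessLoss g b m p / 32
      + (g p.1 p.2.1 - b p.1 p.2.1) ^ 2 / 64 := by
  have h0 := abs_excessLoss_le hg hb hm p
  have h1 : |-(excessLoss g b m p / 32)| ≤ 1 := by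
    rw [abs_neg, abs_div, abs_of_pos (by norm_num : (0 : ℝ) < 32)]
    linarith
  have h2 := (abs_le.1 (Real.abs_exp_sub_one_sub_id_le h1)).2
  have hg := hg p.1 p.2.1
  have hb := hb p.1 p.2.1
  have hm := hm p.2.2.2
  have hr := clip_mem_Icc p.2.2.1
  have h3 : (g p.1 p.2.1 + b p.1 p.2.1 - 2 * clip p.2.2.1 - 2 * m p.2.2.2) ^ 2 ≤ 4 ^ 2 :=
    sq_le_sq' (by linarith [hg.1, hb.1, hm.2, hr.2]) (by linarith [hg.2, hb.2, hm.1, hr.1])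
  have h4 : excessLoss g b m p = (g p.1 p.2.1 - b p.1 p.2.1)
      * (g p.1 p.2.1 + b p.1 p.2.1 - 2 * clip p.2.2.1 - 2 * m p.2.2.2) := by
    rw [excessLoss]; ring
  have h5 : (-(excessLoss g b m p / 32)) ^ 2 ≤ (g p.1 p.2.1 - b p.1 p.2.1) ^ 2 / 64 := by
    rw [h4]
    nlinarith [mul_le_mul_of_nonneg_left h3 (sq_nonneg (g p.1 p.2.1 - b p.1 p.2.1))]
  linarith

variable [MeasurableSingletonClass A] [Fintype A]

namespace MDP

variable {M : MDP X A}

/-- The Bellman operator is the conditional mean of the regression target. -/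
theorem RewardBounded.integral_mul_bellman [Nonempty A] (hM : M.RewardBounded) (π : Policy X A)
    {h : ℕ} (hh : h < M.H) {D : X × A → ℝ} (hD : Measurable D) {B : ℝ} (hDb : ∀ p, |D p| ≤ B)
    {f : X → A → ℝ} (hf : Measurable fun p : X × A => f p.1 p.2)
    (hb : ∀ x a, f x a ∈ Set.Icc (0 : ℝ) 1) :
    ∫ p, D p * M.bellman h f p.1 p.2 ∂M.saLaw π h
      = ∫ p, D (p.1, p.2.1) * (clip p.2.2.1 + maxVal f p.2.2.2) ∂M.trLaw π h := by
  have hm := measurable_maxVal hf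
  have hmb := maxVal_mem_Icc hb
  have hR := hM.integrable_reward_compProd π hh
  have hDR : Integrable (fun q : (X × A) × ℝ => D q.1 * q.2) (M.saLaw π h ⊗ₘ M.R h) :=
    hR.bdd_mul (hD.comp measurable_fst).aestronglyMeasurable
      (Filter.Eventually.of_forall fun q => hDb q.1)
  have hDP : Integrable (fun q : (X × A) × X => D q.1 * maxVal f q.2) (M.saLaw π h ⊗ₘ M.P h) :=
    Integrable.bdd_mul (integrable_of_mem_Icc (hm.comp measurable_snd) fun q => hmb q.2)
      (hD.comp measurable_fst).aestronglyMeasurable (Filter.Eventually.of_forall fun q => hDb q.1)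
  have e1 := Measure.integral_compProd hDR
  have e2 := Measure.integral_compProd hDP
  have hc : ∀ p : X × A, ∫ r, D p * r ∂M.R h p = D p * M.meanReward h p.1 p.2 := fun p =>
    integral_const_mul _ _
  simp only [integral_const_mul, hc] at e1 e2
  have i1 := hDR.integral_measure_compProd
  have i2 := hDP.integral_measure_compProd
  simp only [integral_const_mul, hc] at i1 i2
  have e3 : ∫ p, D p * M.bellman h f p.1 p.2 ∂M.saLaw π h
      = ∫ q, D q.1 * q.2 ∂(M.saLaw π h ⊗ₘ M.R h)
        + ∫ q, D q.1 * maxVal f q.2 ∂(M.saLaw π h ⊗ₘ M.P h) := by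
    rw [e1, e2, ← integral_add i1 i2]
    refine integral_congr_ae (Filter.Eventually.of_forall fun p => ?_)
    exact mul_add _ _ _
  rw [e3]
  rw [← trLaw_map_reward] at hDR ⊢
  rw [← trLaw_map_next] at hDP ⊢
  have hmr : Measurable fun p : Transition X A => ((p.1, p.2.1), p.2.2.1) := by fun_prop
  have hmn : Measurable fun p : Transition X A => ((p.1, p.2.1), p.2.2.2) := by fun_prop
  rw [integral_map hmr.aemeasurable hDR.aestronglyMeasurable,
    integral_map hmn.aemeasurable hDP.aestronglyMeasurable]
  have i3 : Integrable (fun p : Transition X A => D (p.1, p.2.1) * p.2.2.1) (M.trLaw π h) :=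
    hDR.comp_measurable hmr
  have i4 : Integrable (fun p : Transition X A => D (p.1, p.2.1) * maxVal f p.2.2.2)
      (M.trLaw π h) := hDP.comp_measurable hmn
  refine (integral_add i3 i4).symm.trans ?_
  refine integral_congr_ae ?_
  filter_upwards [hM.ae_trLaw_mem π hh] with p hp
  rw [clip_of_mem hp]
  ring

/-- With D = g - b, the excess is D(g + b) minus 2D times the target. Since b is the conditional
mean of the target, the mean becomes that of D(g + b - 2b) = D². -/
theorem RewardBounded.integral_excessLoss [Nonempty A] (hM : M.RewardBounded) (π : Policy X A)
    {h : ℕ} (hh : h < M.H) {g f : X → A → ℝ} (hg : Measurable fun p : X × A => g p.1 p.2)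
    (hgb : ∀ x a, g x a ∈ Set.Icc (0 : ℝ) 1) (hf : Measurable fun p : X × A => f p.1 p.2)
    (hfb : ∀ x a, f x a ∈ Set.Icc (0 : ℝ) 1)
    (hb : Measurable fun p : X × A => M.bellman h f p.1 p.2)
    (hbb : ∀ x a, M.bellman h f x a ∈ Set.Icc (0 : ℝ) 1) :
    ∫ p, excessLoss g (M.bellman h f) (maxVal f) p ∂M.trLaw π h
      = ∫ p, (g p.1 p.2 - M.bellman h f p.1 p.2) ^ 2 ∂M.saLaw π h := by
  set b := M.bellman h f with hbdef
  have hsa : Measurable fun p : Transition X A => (p.1, p.2.1) := by fun_prop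
  let D : X × A → ℝ := fun p => g p.1 p.2 - b p.1 p.2
  have hD : Measurable D := hg.sub hb
  have hDb : ∀ p, |D p| ≤ 1 := fun p => by
    have h1 := hgb p.1 p.2
    have h2 := hbb p.1 p.2
    rw [abs_le]
    constructor <;> linarith [h1.1, h1.2, h2.1, h2.2]
  have h1 := hM.integral_mul_bellman π hh hD hDb hf hfb
  have hbi : Integrable (fun p : X × A => b p.1 p.2) (M.saLaw π h) :=
    integrable_of_mem_Icc hb fun p => hbb _ _
  have hgi : Integrable (fun p : X × A => g p.1 p.2) (M.saLaw π h) :=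
    integrable_of_mem_Icc hg fun p => hgb _ _
  have i1 : Integrable (fun p : X × A => D p * (g p.1 p.2 + b p.1 p.2)) (M.saLaw π h) :=
    (hgi.add hbi).bdd_mul hD.aestronglyMeasurable (Filter.Eventually.of_forall hDb)
  have i2 : Integrable (fun p : X × A => D p * b p.1 p.2) (M.saLaw π h) :=
    hbi.bdd_mul hD.aestronglyMeasurable (Filter.Eventually.of_forall hDb)
  have i3 : Integrable (fun p : Transition X A => D (p.1, p.2.1)
      * (clip p.2.2.1 + maxVal f p.2.2.2)) (M.trLaw π h) := by
    refine Integrable.bdd_mul ?_ (hD.comp hsa).aestronglyMeasurable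
      (Filter.Eventually.of_forall fun p => hDb _)
    exact (integrable_of_mem_Icc (measurable_clip.comp (by fun_prop)) fun p => clip_mem_Icc _).add
      (integrable_of_mem_Icc ((measurable_maxVal hf).comp (by fun_prop)) fun p =>
        maxVal_mem_Icc hfb _)
  have e1 : ∀ p, excessLoss g b (maxVal f) p
      = D (p.1, p.2.1) * (g p.1 p.2.1 + b p.1 p.2.1)
        - 2 * (D (p.1, p.2.1) * (clip p.2.2.1 + maxVal f p.2.2.2)) := by
    intro p
    simp only [excessLoss, D]
    ring
  have e2 : ∫ p, D (p.1, p.2.1) * (g p.1 p.2.1 + b p.1 p.2.1) ∂M.trLaw π h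
      = ∫ p, D p * (g p.1 p.2 + b p.1 p.2) ∂M.saLaw π h := by
    rw [← trLaw_map_sa] at i1 ⊢
    exact (integral_map hsa.aemeasurable i1.aestronglyMeasurable).symm
  have i4 : Integrable (fun p : Transition X A => D (p.1, p.2.1)
      * (g p.1 p.2.1 + b p.1 p.2.1)) (M.trLaw π h) := by
    rw [← trLaw_map_sa] at i1
    exact i1.comp_measurable hsa
  simp_rw [e1]
  rw [integral_sub i4 (i3.const_mul 2), integral_const_mul, e2, ← h1, ← integral_const_mul,
    ← integral_sub i1 (i2.const_mul 2)]
  refine integral_congr_ae (Filter.Eventually.of_forall fun p => ?_)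
  simp only [D]
  ring

/-- The mean of the excess and its second-moment bound involve the same quantity E = E(g - b)², so
the exponential moment is at most 1 - E/32 + E/64 = 1 - E/64. -/
theorem RewardBounded.integral_exp_neg_excessLoss_le [Nonempty A] (hM : M.RewardBounded)
    (π : Policy X A)
    {h : ℕ} (hh : h < M.H) {g f : X → A → ℝ} (hg : Measurable fun p : X × A => g p.1 p.2)
    (hgb : ∀ x a, g x a ∈ Set.Icc (0 : ℝ) 1) (hf : Measurable fun p : X × A => f p.1 p.2)
    (hfb : ∀ x a, f x a ∈ Set.Icc (0 : ℝ) 1)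
    (hb : Measurable fun p : X × A => M.bellman h f p.1 p.2)
    (hbb : ∀ x a, M.bellman h f x a ∈ Set.Icc (0 : ℝ) 1) :
    ∫ p, Real.exp (-(excessLoss g (M.bellman h f) (maxVal f) p / 32)) ∂M.trLaw π h
      ≤ Real.exp (-((∫ p, (g p.1 p.2 - M.bellman h f p.1 p.2) ^ 2 ∂M.saLaw π h) / 64)) := by
  have hY := measurable_excessLoss hg hb (measurable_maxVal hf)
  have hYb := abs_excessLoss_le hgb hbb (maxVal_mem_Icc hfb)
  have hsa : Measurable fun p : Transition X A => (p.1, p.2.1) := by fun_prop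
  have hD2 : Integrable (fun p : X × A => (g p.1 p.2 - M.bellman h f p.1 p.2) ^ 2)
      (M.saLaw π h) := by
    refine integrable_of_mem_Icc ((hg.sub hb).pow_const 2) fun p => ⟨sq_nonneg _, ?_⟩
    have h1 := hgb p.1 p.2
    have h2 := hbb p.1 p.2
    rw [sq_le_one_iff_abs_le_one, abs_le]
    constructor <;> linarith [h1.1, h1.2, h2.1, h2.2]
  have e2 : ∫ p, (g p.1 p.2.1 - M.bellman h f p.1 p.2.1) ^ 2 ∂M.trLaw π h
      = ∫ p, (g p.1 p.2 - M.bellman h f p.1 p.2) ^ 2 ∂M.saLaw π h := by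
    rw [← trLaw_map_sa] at hD2 ⊢
    exact (integral_map hsa.aemeasurable hD2.aestronglyMeasurable).symm
  have i2 : Integrable (fun p : Transition X A =>
      (g p.1 p.2.1 - M.bellman h f p.1 p.2.1) ^ 2) (M.trLaw π h) := by
    rw [← trLaw_map_sa] at hD2
    exact hD2.comp_measurable hsa
  have i1 : Integrable (excessLoss g (M.bellman h f) (maxVal f)) (M.trLaw π h) :=
    Integrable.of_bound hY.aestronglyMeasurable 4 (Filter.Eventually.of_forall hYb)
  have i0 : Integrable (fun p => Real.exp (-(excessLoss g (M.bellman h f) (maxVal f) p / 32)))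
      (M.trLaw π h) := by
    refine Integrable.of_bound (hY.div_const 32).neg.exp.aestronglyMeasurable (Real.exp 1)
      (Filter.Eventually.of_forall fun p => ?_)
    rw [Real.norm_eq_abs, Real.abs_exp]
    exact Real.exp_le_exp.2 (by linarith [(abs_le.1 (hYb p)).1])
  have i3 : Integrable (fun p => 1 - excessLoss g (M.bellman h f) (maxVal f) p / 32)
      (M.trLaw π h) := (integrable_const 1).sub (i1.div_const 32)
  refine (integral_mono i0 (i3.add (i2.div_const 64))
    fun p => exp_neg_excessLoss_le hgb hbb (maxVal_mem_Icc hfb) p).trans ?_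
  refine (integral_add i3 (i2.div_const 64)).le.trans ?_
  rw [integral_sub (integrable_const 1) (i1.div_const 32), integral_div, integral_div,
    hM.integral_excessLoss π hh hg hgb hf hfb hb hbb, e2]
  simp only [integral_const, probReal_univ, smul_eq_mul, mul_one]
  refine le_trans (le_of_eq ?_) (Real.add_one_le_exp _)
  ring

end MDP

end MyopicRL

/-! ### Covers, and concentration for a fixed pair of functions -/

namespace MyopicRL

variable {X : Type u} {A : Type v} [MeasurableSpace X] [MeasurableSpace A]

section Approximation

omit [MeasurableSpace X] [MeasurableSpace A] in
theorem abs_maxVal_sub_le [Fintype A] [Nonempty A] {f f' : X → A → ℝ} {r : ℝ}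
    (h : ∀ x a, |f x a - f' x a| ≤ r) (x : X) : |maxVal f x - maxVal f' x| ≤ r := by
  rw [abs_sub_le_iff]
  constructor
  · rw [sub_le_iff_le_add]
    exact ciSup_le fun a => by linarith [(abs_le.1 (h x a)).2, le_maxVal f' x a]
  · rw [sub_le_iff_le_add]
    exact ciSup_le fun a => by linarith [(abs_le.1 (h x a)).1, le_maxVal f x a]

theorem MDP.abs_bellman_sub_le [Fintype A] [Nonempty A] (M : MDP X A) (h : ℕ) {f f' : X → A → ℝ}
    {r : ℝ}
    (hf : Measurable fun p : X × A => f p.1 p.2) (hfb : ∀ x a, f x a ∈ Set.Icc (0 : ℝ) 1)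
    (hf' : Measurable fun p : X × A => f' p.1 p.2) (hfb' : ∀ x a, f' x a ∈ Set.Icc (0 : ℝ) 1)
    (hr : ∀ x a, |f x a - f' x a| ≤ r) (x : X) (a : A) :
    |M.bellman h f x a - M.bellman h f' x a| ≤ r := by
  have h1 : Integrable (maxVal f) (M.P h (x, a)) :=
    integrable_of_mem_Icc (measurable_maxVal hf) (maxVal_mem_Icc hfb)
  have h2 : Integrable (maxVal f') (M.P h (x, a)) :=
    integrable_of_mem_Icc (measurable_maxVal hf') (maxVal_mem_Icc hfb')
  rw [MDP.bellman, MDP.bellman, add_sub_add_left_eq_sub, ← integral_sub h1 h2]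
  have := norm_integral_le_of_norm_le_const (μ := M.P h (x, a))
    (f := fun y => maxVal f y - maxVal f' y) (C := r)
    (Filter.Eventually.of_forall (abs_maxVal_sub_le hr))
  simpa using this

theorem abs_sq_sub_sq_le {u v r : ℝ} (hu : |u| ≤ 2) (hv : |v| ≤ 2) (h : |u - v| ≤ 2 * r) :
    |u ^ 2 - v ^ 2| ≤ 8 * r := by
  rw [sq_sub_sq, abs_mul]
  have h1 : |u + v| ≤ 4 := (abs_add_le u v).trans (by linarith)
  nlinarith [abs_nonneg (u - v), abs_nonneg (u + v)]

omit [MeasurableSpace X] [MeasurableSpace A] in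
-- Each of the two squares moves by at most 4 · 2r, as its base has modulus at most 2 and moves by
-- at most 2r.
theorem abs_excessLoss_sub_le {g g' b b' : X → A → ℝ} {m m' : X → ℝ} {r : ℝ}
    (hg : ∀ x a, g x a ∈ Set.Icc (0 : ℝ) 1) (hg' : ∀ x a, g' x a ∈ Set.Icc (0 : ℝ) 1)
    (hb : ∀ x a, b x a ∈ Set.Icc (0 : ℝ) 1) (hb' : ∀ x a, b' x a ∈ Set.Icc (0 : ℝ) 1)
    (hm : ∀ x, m x ∈ Set.Icc (0 : ℝ) 1) (hm' : ∀ x, m' x ∈ Set.Icc (0 : ℝ) 1)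
    (hgr : ∀ x a, |g x a - g' x a| ≤ r) (hbr : ∀ x a, |b x a - b' x a| ≤ r)
    (hmr : ∀ x, |m x - m' x| ≤ r) (p : Transition X A) :
    |excessLoss g b m p - excessLoss g' b' m' p| ≤ 16 * r := by
  have key : ∀ u u' w w' c : ℝ, u ∈ Set.Icc (0 : ℝ) 1 → u' ∈ Set.Icc (0 : ℝ) 1 →
      w ∈ Set.Icc (0 : ℝ) 1 → w' ∈ Set.Icc (0 : ℝ) 1 → c ∈ Set.Icc (0 : ℝ) 1 →
      |u - u'| ≤ r → |w - w'| ≤ r → |(u - c - w) ^ 2 - (u' - c - w') ^ 2| ≤ 8 * r := by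
    intro u u' w w' c hu hu' hw hw' hc h1 h2
    refine abs_sq_sub_sq_le ?_ ?_ ?_
    · rw [abs_le]; constructor <;> linarith [hu.1, hu.2, hw.1, hw.2, hc.1, hc.2]
    · rw [abs_le]; constructor <;> linarith [hu'.1, hu'.2, hw'.1, hw'.2, hc.1, hc.2]
    · rw [abs_le] at *; constructor <;> linarith [h1.1, h1.2, h2.1, h2.2]
  have k1 := key _ _ _ _ _ (hg p.1 p.2.1) (hg' p.1 p.2.1) (hm p.2.2.2) (hm' p.2.2.2)
    (clip_mem_Icc p.2.2.1) (hgr _ _) (hmr _)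
  have k2 := key _ _ _ _ _ (hb p.1 p.2.1) (hb' p.1 p.2.1) (hm p.2.2.2) (hm' p.2.2.2)
    (clip_mem_Icc p.2.2.1) (hbr _ _) (hmr _)
  rw [excessLoss, excessLoss]
  rw [abs_le] at *
  constructor <;> linarith [k1.1, k1.2, k2.1, k2.2]

end Approximation

section Covers

variable {M : MDP X A} {F : FnClass M}

theorem FnClass.exists_finite_cover {h : ℕ} {r : ℝ} (hfin : F.coverNum h r ≠ ⊤) :
    ∃ Z : Finset (X → A → ℝ), (∀ g ∈ Z, g ∈ F.part h) ∧
      (∀ f ∈ F.part h, ∃ g ∈ Z, ∀ x a, |f x a - g x a| ≤ r) ∧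
      (Z.card : ℕ∞) ≤ F.coverNum h r := by
  -- A finite infimum in `ℕ∞` is attained: a cover with fewer than `coverNum + 1` elements is an
  -- optimal one.
  have h1 : F.coverNum h r < F.coverNum h r + 1 := by
    lift F.coverNum h r to ℕ using hfin with n
    exact_mod_cast Nat.lt_succ_self n
  conv_lhs at h1 => rw [FnClass.coverNum]
  simp only [iInf_lt_iff] at h1
  obtain ⟨Z, hZ, hc, hlt⟩ := h1
  have hle : Z.encard ≤ F.coverNum h r := Order.le_of_lt_add_one hlt
  have hZf : Z.Finite := Set.encard_ne_top_iff.1 fun h => hfin (top_le_iff.1 (h ▸ hle))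
  refine ⟨hZf.toFinset, fun g hg => hZ (hZf.mem_toFinset.1 hg), fun f hf => ?_, ?_⟩
  · obtain ⟨g, hg, h2⟩ := hc f hf
    exact ⟨g, hZf.mem_toFinset.2 hg, h2⟩
  · rwa [← Set.encard_coe_eq_coe_finsetCard, hZf.coe_toFinset]

theorem FnClass.exists_covers (hF : ∀ h < M.H, (F.part h).Nonempty) {r : ℝ} (hr : 0 ≤ r) {N : ℕ}
    (hN : F.coverSum r = N) :
    ∃ Z : ℕ → Finset (X → A → ℝ), (∀ h, ∀ g ∈ Z h, g ∈ F.part h) ∧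
      (∀ h, ∀ f ∈ F.part h, ∃ g ∈ Z h, ∀ x a, |f x a - g x a| ≤ r) ∧
      ∑ h ∈ Finset.range M.H, (Z h).card ≤ N ∧ ∀ h ≤ M.H, 0 < M.H → (Z h).card ≤ N := by
  have hfin : ∀ h < M.H, F.coverNum h r ≠ ⊤ := by
    intro h hh htop
    have h1 : F.coverNum h r ≤ F.coverSum r :=
      Finset.single_le_sum (f := fun h => F.coverNum h r) (fun _ _ => zero_le)
        (Finset.mem_range.2 hh)
    rw [htop, hN, top_le_iff] at h1
    exact ENat.natCast_ne_top N h1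
  have h0 : ∀ h, ∃ Z : Finset (X → A → ℝ), (∀ g ∈ Z, g ∈ F.part h) ∧
      (∀ f ∈ F.part h, ∃ g ∈ Z, ∀ x a, |f x a - g x a| ≤ r) ∧
      (h < M.H → (Z.card : ℕ∞) ≤ F.coverNum h r) ∧ (M.H ≤ h → Z.card = 1) := by
    intro h
    rcases lt_or_ge h M.H with hh | hh
    · obtain ⟨Z, h1, h2, h3⟩ := F.exists_finite_cover (hfin h hh)
      exact ⟨Z, h1, h2, fun _ => h3, fun h4 => absurd hh h4.not_gt⟩
    · refine ⟨{0}, ?_, ?_, fun h4 => absurd h4 hh.not_gt, fun _ => Finset.card_singleton _⟩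
      · rw [F.terminal h hh]; simp
      · rw [F.terminal h hh]
        rintro f rfl
        exact ⟨0, Finset.mem_singleton_self _, fun x a => by simpa using hr⟩
  choose Z h1 h2 h3 h4 using h0
  have hsum : ∑ h ∈ Finset.range M.H, (Z h).card ≤ N := by
    have h5 : ((∑ h ∈ Finset.range M.H, (Z h).card : ℕ) : ℕ∞) ≤ (N : ℕ∞) := by
      rw [← hN, FnClass.coverSum, Nat.cast_sum]
      exact Finset.sum_le_sum fun h hh => h3 h (Finset.mem_range.1 hh)
    exact_mod_cast h5
  have hle : ∀ h < M.H, (Z h).card ≤ N := fun h hh =>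
    (Finset.single_le_sum (f := fun h => (Z h).card) (fun _ _ => Nat.zero_le _)
      (Finset.mem_range.2 hh)).trans hsum
  -- The terminal index is included because the regression at the last step uses the cover {0}
  -- there; its single element is paid for by N ≥ 1.
  refine ⟨Z, h1, h2, hsum, fun h hh hpos => ?_⟩
  rcases hh.lt_or_eq with hlt | heq
  · exact hle h hlt
  · rw [h4 h heq.ge]
    obtain ⟨f, hf⟩ := hF 0 hpos
    obtain ⟨g, hg, _⟩ := h2 0 f hf
    exact (Finset.card_pos.2 ⟨g, hg⟩).trans_le (hle 0 hpos)

end Covers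

namespace Run

variable {M : MDP X A} {F : FnClass M} {expl : ValueFn X A → Policy X A}
  {Ω : Type w} [mΩ : MeasurableSpace Ω] {μ : Measure Ω} [IsProbabilityMeasure μ]

omit [IsProbabilityMeasure μ] in
theorem measurable_ep (run : Run F expl μ) (t : ℕ) : Measurable (run.ep t) :=
  (run.ep_adapted t).mono (run.ℋ.le _) le_rfl

theorem condExp_comp_ep (run : Run F expl μ) (t : ℕ) {φ : M.Episode → ℝ} (hφ : Measurable φ)
    {B : ℝ} (hB : ∀ e, |φ e| ≤ B) :
    μ[φ ∘ run.ep t | run.ℋ t] =ᵐ[μ] fun ω => ∫ e, φ e ∂M.law (expl (run.fhat t ω)) :=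
  condExp_comp_ae_eq_integral (run.measurable_ep t) (run.ep_law t) hφ hB

/-- Integrating the conditional law of an episode turns an event that is null under every policy
into a null event of the run. -/
theorem ae_ep_mem (run : Run F expl μ) (t : ℕ) {S : Set M.Episode} (hS : MeasurableSet S)
    (h : ∀ π, ∀ᵐ e ∂M.law π, e ∈ S) : ∀ᵐ ω ∂μ, run.ep t ω ∈ S := by
  have h1 : ∀ π, (M.law π).real Sᶜ = 0 := fun π => by
    rw [Measure.real, show M.law π Sᶜ = 0 from h π, ENNReal.toReal_zero]
  have h2 := run.ep_law t Sᶜ hS.compl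
  simp_rw [h1] at h2
  have hm := run.measurable_ep t hS.compl
  have h3 : μ.real (run.ep t ⁻¹' Sᶜ) = 0 := by
    have h4 := integral_condExp (μ := μ) (run.ℋ.le t)
      (f := (run.ep t ⁻¹' Sᶜ).indicator (fun _ => (1 : ℝ)))
    rw [integral_congr_ae h2, integral_indicator_const _ hm] at h4
    simpa using h4.symm
  exact (measureReal_eq_zero_iff).1 h3

variable [MeasurableSingletonClass A] [Fintype A] [Nonempty A]

/-- The pair `g`, `f` is fixed here, so the summands are adapted and the supermartingale bound
applies; the data-dependent estimates are reached later through the cover. -/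
theorem measure_lt_excessLoss_le (hM : M.RewardBounded) (hF : F.Complete) (run : Run F expl μ)
    (h : Fin M.H) {g f : X → A → ℝ} (hg : g ∈ F.part h) (hf : f ∈ F.part (h + 1)) (t : ℕ)
    {δ : ℝ} (hδ : 0 < δ) :
    μ {ω | Real.log (1 / δ) < ∑ s ∈ Finset.range t,
      ((∫ p, (g p.1 p.2 - M.bellman h f p.1 p.2) ^ 2 ∂M.occ (expl (run.fhat s ω)) h) / 64
        - excessLoss g (M.bellman h f) (maxVal f) (run.ep s ω h) / 32)} ≤ ENNReal.ofReal δ := by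
  have hb := hF.complete h h.2 f hf
  have hgm := F.measurable _ _ hg
  have hfm := F.measurable _ _ hf
  have hbm := F.measurable _ _ hb
  have hgb := F.mem_Icc _ _ hg
  have hfb := F.mem_Icc _ _ hf
  have hbb := F.mem_Icc _ _ hb
  set b := M.bellman h f with hbdef
  have hsa : Measurable fun e : M.Episode => ((e h).1, (e h).2.1) :=
    (by fun_prop : Measurable fun p : Transition X A => (p.1, p.2.1)).comp (MDP.measurable_eval h)
  have hD : Measurable fun p : X × A => (g p.1 p.2 - b p.1 p.2) ^ 2 := (hgm.sub hbm).pow_const 2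
  have hDb : ∀ p : X × A, (g p.1 p.2 - b p.1 p.2) ^ 2 ∈ Set.Icc (0 : ℝ) 1 := fun p => by
    refine ⟨sq_nonneg _, ?_⟩
    have h1 := hgb p.1 p.2
    have h2 := hbb p.1 p.2
    rw [sq_le_one_iff_abs_le_one, abs_le]
    constructor <;> linarith [h1.1, h1.2, h2.1, h2.2]
  let φ : M.Episode → ℝ := fun e => (g (e h).1 (e h).2.1 - b (e h).1 (e h).2.1) ^ 2 / 64
  have hφ : Measurable φ := (hD.comp hsa).div_const 64
  have hφb : ∀ e, |φ e| ≤ 1 := fun e => by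
    have h1 := hDb ((e h).1, (e h).2.1)
    rw [abs_of_nonneg (div_nonneg h1.1 (by norm_num))]
    change _ / (64 : ℝ) ≤ 1
    rw [div_le_iff₀ (by norm_num)]
    linarith [h1.2]
  have hφint : ∀ π, ∫ e, φ e ∂M.law π
      = (∫ p, (g p.1 p.2 - b p.1 p.2) ^ 2 ∂M.occ π h) / 64 := by
    intro π
    rw [MDP.occ, integral_map hsa.aemeasurable hD.aestronglyMeasurable, ← integral_div]
  have hY := measurable_excessLoss hgm hbm (measurable_maxVal hfm)
  have hYb := abs_excessLoss_le hgb hbb (maxVal_mem_Icc hfb)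
  let ψ : M.Episode → ℝ := fun e => Real.exp (-(excessLoss g b (maxVal f) (e h) / 32))
  have hψ : Measurable ψ := ((hY.comp (MDP.measurable_eval h)).div_const 32).neg.exp
  have hψb : ∀ e, |ψ e| ≤ Real.exp 1 := fun e => by
    rw [Real.abs_exp]
    exact Real.exp_le_exp.2 (by linarith [(abs_le.1 (hYb (e h))).1])
  have hψint : ∀ π, ∫ e, ψ e ∂M.law π ≤ Real.exp (-(∫ e, φ e ∂M.law π)) := by
    intro π
    have h1 := hM.integral_exp_neg_excessLoss_le π h.2 hgm hgb hfm hfb hbm hbb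
    rw [hφint, MDP.occ_eq]
    refine le_trans (le_of_eq ?_) h1
    rw [← MDP.law_map_eval]
    exact (integral_map (MDP.measurable_eval h).aemeasurable
      (hY.div_const 32).neg.exp.aestronglyMeasurable).symm
  have hq := fun s => run.condExp_comp_ep s hφ hφb
  -- The compensator is the conditional expectation itself, which is adapted by construction; it
  -- agrees almost surely with the integral under the exploration policy of the estimate.
  have key := measure_log_lt_sum_le (μ := μ) (ℋ := run.ℋ)
    (Y := fun s ω => excessLoss g b (maxVal f) (run.ep s ω h) / 32)
    (q := fun s => μ[φ ∘ run.ep s | run.ℋ s]) (B := 1)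
    (fun s => (hY.div_const 32).comp ((MDP.measurable_eval h).comp (run.ep_adapted s)))
    (fun s => stronglyMeasurable_condExp.measurable)
    (fun s => Filter.Eventually.of_forall fun ω => by
      rw [abs_div, abs_of_pos (by norm_num : (0 : ℝ) < 32), div_le_iff₀ (by norm_num)]
      linarith [hYb (run.ep s ω h)])
    (fun s => ae_bdd_abs_condExp_of_ae_bdd_abs (Filter.Eventually.of_forall fun ω => hφb _))
    (fun s => by
      filter_upwards [run.condExp_comp_ep s hψ hψb, hq s] with ω h1 h2
      rw [h2]
      exact h1.le.trans (hψint _)) t hδ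
  refine le_trans (measure_mono_ae ?_) key
  filter_upwards [ae_all_iff.2 hq] with ω hω h1
  refine lt_of_lt_of_eq h1 (Finset.sum_congr rfl fun s _ => ?_)
  rw [hω s, hφint]

end Run

end MyopicRL

/-! ### Small Bellman residuals on past exploration policies -/

namespace MyopicRL

variable {X : Type u} {A : Type v} [MeasurableSpace X] [MeasurableSpace A]
  [Fintype A] [Nonempty A] {M : MDP X A} {F : FnClass M}

omit [Fintype A] [Nonempty A] in
theorem FnClass.residual_mem_Icc (hF : F.Complete) {f : ValueFn X A} (hf : f ∈ F.fns) {h : ℕ}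
    (hh : h < M.H) (p : X × A) : M.residual h f p ∈ Set.Icc (-1 : ℝ) 1 := by
  have h1 := F.mem_Icc _ _ (hf h) p.1 p.2
  have h2 := F.mem_Icc _ _ (hF.complete h hh _ (hf (h + 1))) p.1 p.2
  rw [MDP.residual]
  constructor <;> linarith [h1.1, h1.2, h2.1, h2.2]

omit [Fintype A] [Nonempty A] in
theorem FnClass.measurable_residual (hF : F.Complete) {f : ValueFn X A} (hf : f ∈ F.fns) {h : ℕ}
    (hh : h < M.H) : Measurable (M.residual h f) :=
  (F.measurable _ _ (hf h)).sub (F.measurable _ _ (hF.complete h hh _ (hf (h + 1))))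

omit [Fintype A] [Nonempty A] in
theorem FnClass.integrable_sq_residual (hF : F.Complete) {f : ValueFn X A} (hf : f ∈ F.fns)
    {h : ℕ} (hh : h < M.H) (ν : Measure (X × A)) [IsFiniteMeasure ν] :
    Integrable (fun p => M.residual h f p ^ 2) ν :=
  integrable_of_mem_Icc ((F.measurable_residual hF hf hh).pow_const 2) fun p => by
    have h1 := F.residual_mem_Icc hF hf hh p
    exact ⟨sq_nonneg _, (sq_le_one_iff_abs_le_one _).2 (abs_le.2 h1)⟩

variable [MeasurableSingletonClass A]

omit [MeasurableSingletonClass A] in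
/-- Least-squares estimates which are close to elements of a cover with concentrated losses have small
squared Bellman residuals. -/
theorem FnClass.sum_integral_sq_residual_le (hF : F.Complete) {h : Fin M.H}
    {f : ValueFn X A} (hf : f ∈ F.fns) {data : ℕ → M.Episode} {t T : ℕ} (htT : t ≤ T) (hT : 0 < T)
    (hdata : ∀ s, (data s h).2.2.1 ∈ Set.Icc (0 : ℝ) 1)
    (hmin : ∀ g ∈ F.part h, sqLoss data t h (f h) (f (h + 1)) ≤ sqLoss data t h g (f (h + 1)))
    {g f' : X → A → ℝ} (hg : g ∈ F.part h) (hf' : f' ∈ F.part (h + 1))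
    (hgf : ∀ x a, |f h x a - g x a| ≤ 1 / (T : ℝ))
    (hff : ∀ x a, |f (h + 1) x a - f' x a| ≤ 1 / (T : ℝ)) {π : ℕ → Policy X A} {c : ℝ}
    (hc : ∑ s ∈ Finset.range t,
      ((∫ p, (g p.1 p.2 - M.bellman h f' p.1 p.2) ^ 2 ∂M.occ (π s) h) / 64
        - excessLoss g (M.bellman h f') (maxVal f') (data s h) / 32) ≤ c) :
    ∑ s ∈ Finset.range t, ∫ p, M.residual h f p ^ 2 ∂M.occ (π s) h ≤ 36 + 64 * c := by
  have hb0 := hF.complete h h.2 _ (hf (h + 1))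
  have hb := hF.complete h h.2 _ hf'
  have hbr := M.abs_bellman_sub_le h (F.measurable _ _ (hf (h + 1))) (F.mem_Icc _ _ (hf (h + 1)))
    (F.measurable _ _ hf') (F.mem_Icc _ _ hf') hff
  -- By completeness the Bellman image is a competitor in the least-squares problem. On the data the
  -- rewards lie in [0, 1], so clipping has no effect.
  have hex : ∑ s ∈ Finset.range t, excessLoss (f h) (M.bellman h (f (h + 1))) (maxVal (f (h + 1)))
      (data s h) ≤ 0 := by
    have h1 := hmin _ hb0
    rw [sqLoss, sqLoss, ← sub_nonpos, ← Finset.sum_sub_distrib] at h1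
    refine le_trans (le_of_eq (Finset.sum_congr rfl fun s _ => ?_)) h1
    rw [excessLoss, clip_of_mem (hdata s)]
  have hTR : (0 : ℝ) < T := by exact_mod_cast hT
  have htT' : (t : ℝ) * (1 / T) ≤ 1 := by
    rw [mul_one_div, div_le_one hTR]; exact_mod_cast htT
  -- Passing to the cover costs 16/T per episode, over at most T episodes.
  have hex' : ∑ s ∈ Finset.range t, excessLoss g (M.bellman h f') (maxVal f') (data s h) ≤ 16 := by
    calc _ ≤ ∑ s ∈ Finset.range t, (excessLoss (f h) (M.bellman h (f (h + 1)))
          (maxVal (f (h + 1))) (data s h) + 16 * (1 / (T : ℝ))) := by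
          refine Finset.sum_le_sum fun s _ => ?_
          have := abs_excessLoss_sub_le (F.mem_Icc _ _ (hf h)) (F.mem_Icc _ _ hg)
            (F.mem_Icc _ _ hb0) (F.mem_Icc _ _ hb) (maxVal_mem_Icc (F.mem_Icc _ _ (hf (h + 1))))
            (maxVal_mem_Icc (F.mem_Icc _ _ hf')) hgf hbr (abs_maxVal_sub_le hff) (data s h)
          linarith [(abs_le.1 this).1]
      _ ≤ 16 := by
          rw [Finset.sum_add_distrib, Finset.sum_const, Finset.card_range, nsmul_eq_mul]
          linarith
  have hD2 : ∀ ν : Measure (X × A), ∀ _ : IsProbabilityMeasure ν,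
      ∫ p, M.residual h f p ^ 2 ∂ν
        ≤ ∫ p, (g p.1 p.2 - M.bellman h f' p.1 p.2) ^ 2 ∂ν + 4 * (1 / (T : ℝ)) := by
    intro ν _
    have i1 := F.integrable_sq_residual hF hf h.2 ν
    have hb1 : ∀ p : X × A, |g p.1 p.2 - M.bellman h f' p.1 p.2| ≤ 1 := fun p => by
      have h1 := F.mem_Icc _ _ hg p.1 p.2
      have h2 := F.mem_Icc _ _ hb p.1 p.2
      rw [abs_le]
      constructor <;> linarith [h1.1, h1.2, h2.1, h2.2]
    have i2 : Integrable (fun p : X × A => (g p.1 p.2 - M.bellman h f' p.1 p.2) ^ 2) ν :=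
      integrable_of_mem_Icc (((F.measurable _ _ hg).sub (F.measurable _ _ hb)).pow_const 2)
        fun p => ⟨sq_nonneg _, (sq_le_one_iff_abs_le_one _).2 (hb1 p)⟩
    have h3 : ∫ p, M.residual h f p ^ 2 ∂ν
        ≤ ∫ p, ((g p.1 p.2 - M.bellman h f' p.1 p.2) ^ 2 + 4 * (1 / (T : ℝ))) ∂ν := by
      refine integral_mono i1 (i2.add (integrable_const _)) fun p => ?_
      have h4 := abs_le.1 (hgf p.1 p.2)
      have h5 := abs_le.1 (hbr p.1 p.2)
      have h6 := F.residual_mem_Icc hF hf h.2 p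
      have h7 := abs_le.1 (hb1 p)
      have h8 : |M.residual h f p - (g p.1 p.2 - M.bellman h f' p.1 p.2)| ≤ 2 * (1 / (T : ℝ)) := by
        rw [MDP.residual, abs_le]
        constructor <;> linarith [h4.1, h4.2, h5.1, h5.2]
      have h9 : |M.residual h f p + (g p.1 p.2 - M.bellman h f' p.1 p.2)| ≤ 2 := by
        rw [abs_le]
        constructor <;> linarith [h6.1, h6.2, h7.1, h7.2]
      have h10 := le_abs_self (M.residual h f p ^ 2 - (g p.1 p.2 - M.bellman h f' p.1 p.2) ^ 2)
      rw [sq_sub_sq, abs_mul] at h10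
      have h11 := mul_le_mul h9 h8 (abs_nonneg _) (by norm_num)
      change M.residual h f p ^ 2
        ≤ (g p.1 p.2 - M.bellman h f' p.1 p.2) ^ 2 + 4 * (1 / (T : ℝ))
      rw [← sq_sub_sq] at h10
      linarith
    refine h3.trans (le_of_eq ?_)
    rw [integral_add i2 (integrable_const _)]
    simp
  calc ∑ s ∈ Finset.range t, ∫ p, M.residual h f p ^ 2 ∂M.occ (π s) h
      ≤ ∑ s ∈ Finset.range t,
        (∫ p, (g p.1 p.2 - M.bellman h f' p.1 p.2) ^ 2 ∂M.occ (π s) h + 4 * (1 / (T : ℝ))) :=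
        Finset.sum_le_sum fun s _ => hD2 _ inferInstance
    -- Multiplying `hc` by 64 turns the excess bound 16 into 2 · 16 = 32; the replacement of the
    -- residual by its cover version adds 4/T for each of at most T episodes.
    _ ≤ 36 + 64 * c := by
        rw [Finset.sum_add_distrib, Finset.sum_const, Finset.card_range, nsmul_eq_mul]
        rw [Finset.sum_sub_distrib, ← Finset.sum_div, ← Finset.sum_div] at hc
        linarith

namespace Run

variable {expl : ValueFn X A → Policy X A}
  {Ω : Type w} [mΩ : MeasurableSpace Ω] {μ : Measure Ω} [IsProbabilityMeasure μ]

/-- With high probability all estimates have small squared Bellman residuals on the past policies. -/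
theorem measure_residual_le (hM : M.RewardBounded) (hF : F.Complete) (run : Run F expl μ)
    {T : ℕ} (hT : 0 < T) {N : ℕ} (hN : F.coverSum (1 / (T : ℝ)) = N) {δ : ℝ} (hδ : 0 < δ) :
    μ {ω | ¬ ((∀ t, run.fhat t ω ∈ F.fns) ∧ ∀ t < T, ∀ h : Fin M.H,
      ∑ s ∈ Finset.range t,
        ∫ p, M.residual h (run.fhat t ω) p ^ 2 ∂M.occ (expl (run.fhat s ω)) h
          ≤ 36 + 64 * Real.log (T * (N : ℝ) ^ 2 / δ))} ≤ ENNReal.ofReal δ := by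
  obtain ⟨Z, hZ, hcov, hsum, hcard⟩ := FnClass.exists_covers (F := F)
    (fun h hh => ⟨_, hF.realizable h hh⟩) (one_div_nonneg.2 (Nat.cast_nonneg T)) hN
  have hTR : (0 : ℝ) < T := by exact_mod_cast hT
  have hgood : ∀ᵐ ω ∂μ, (∀ t, run.fhat t ω ∈ F.fns) ∧
      (∀ t, ∀ h : Fin M.H, ∀ g ∈ F.part h,
        sqLoss (fun s => run.ep s ω) t h (run.fhat t ω h) (run.fhat t ω (h + 1))
          ≤ sqLoss (fun s => run.ep s ω) t h g (run.fhat t ω (h + 1))) ∧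
      ∀ s, ∀ h : Fin M.H, (run.ep s ω h).2.2.1 ∈ Set.Icc (0 : ℝ) 1 := by
    have h3 : ∀ s, ∀ h : Fin M.H, ∀ᵐ ω ∂μ, (run.ep s ω h).2.2.1 ∈ Set.Icc (0 : ℝ) 1 := by
      intro s h
      have hmr : Measurable fun p : Transition X A => p.2.2.1 := by fun_prop
      refine run.ae_ep_mem s (S := {e | (e h).2.2.1 ∈ Set.Icc (0 : ℝ) 1})
        ((hmr.comp (MDP.measurable_eval h)) measurableSet_Icc) fun π => ?_
      have h4 := hM.ae_trLaw_mem π h.2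
      rw [← MDP.law_map_eval] at h4
      exact ae_of_ae_map (MDP.measurable_eval h).aemeasurable h4
    filter_upwards [ae_all_iff.2 run.fhat_mem, ae_all_iff.2 run.fhat_argmin,
      ae_all_iff.2 fun s => ae_all_iff.2 (h3 s)] with ω h1 h2 h3
    exact ⟨h1, h2, h3⟩
  rcases Nat.eq_zero_or_pos M.H with hH | hH
  · refine le_trans (le_of_eq ?_) zero_le
    change ∀ᵐ ω ∂μ, _
    filter_upwards [hgood] with ω hω
    exact ⟨hω.1, fun t _ h => absurd h.2 (by omega)⟩
  have hNpos : 0 < N := by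
    obtain ⟨g, hg, _⟩ := hcov 0 _ (hF.realizable 0 hH)
    exact (Finset.card_pos.2 ⟨g, hg⟩).trans_le (hcard 0 (Nat.zero_le _) hH)
  have hNR : (0 : ℝ) < N := by exact_mod_cast hNpos
  -- The union runs over T episodes and, at each step h, over pairs from the covers at h and h + 1;
  -- these pairs number at most N² in total over the steps.
  let δ' : ℝ := δ / (T * (N : ℝ) ^ 2)
  have hδ' : 0 < δ' := by positivity
  have hinv : 1 / δ' = T * (N : ℝ) ^ 2 / δ := one_div_div _ _
  let Bad : ℕ → Fin M.H → (X → A → ℝ) → (X → A → ℝ) → Set Ω := fun t h g f =>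
    {ω | Real.log (1 / δ') < ∑ s ∈ Finset.range t,
      ((∫ p, (g p.1 p.2 - M.bellman h f p.1 p.2) ^ 2 ∂M.occ (expl (run.fhat s ω)) h) / 64
        - excessLoss g (M.bellman h f) (maxVal f) (run.ep s ω h) / 32)}
  have hbad : μ (⋃ t ∈ Finset.range T, ⋃ h ∈ (Finset.univ : Finset (Fin M.H)), ⋃ g ∈ Z h,
      ⋃ f ∈ Z (h + 1), Bad t h g f) ≤ ENNReal.ofReal δ := by
    calc _ ≤ ∑ t ∈ Finset.range T, ∑ h : Fin M.H, ∑ g ∈ Z h, ∑ f ∈ Z (h + 1),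
          ENNReal.ofReal δ' := by
          refine (measure_biUnion_finset_le _ _).trans (Finset.sum_le_sum fun t _ => ?_)
          refine (measure_biUnion_finset_le _ _).trans (Finset.sum_le_sum fun h _ => ?_)
          refine (measure_biUnion_finset_le _ _).trans (Finset.sum_le_sum fun g hg => ?_)
          refine (measure_biUnion_finset_le _ _).trans (Finset.sum_le_sum fun f hf => ?_)
          exact run.measure_lt_excessLoss_le hM hF h (hZ _ _ hg) (hZ _ _ hf) t hδ'
      _ = ((T * ∑ h ∈ Finset.range M.H, (Z h).card * (Z (h + 1)).card : ℕ) : ENNReal)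
          * ENNReal.ofReal δ' := by
          rw [Finset.sum_range (fun h => (Z h).card * (Z (h + 1)).card)]
          simp only [Finset.sum_const, nsmul_eq_mul, Finset.card_range]
          push_cast
          rw [mul_assoc, Finset.sum_mul]
          simp only [mul_assoc]
      _ ≤ ((T * N ^ 2 : ℕ) : ENNReal) * ENNReal.ofReal δ' := by
          refine mul_le_mul_left ?_ _
          refine Nat.cast_le.2 (Nat.mul_le_mul_left T ?_)
          calc ∑ h ∈ Finset.range M.H, (Z h).card * (Z (h + 1)).card
              ≤ ∑ h ∈ Finset.range M.H, (Z h).card * N :=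
                Finset.sum_le_sum fun h hh =>
                  Nat.mul_le_mul_left _ (hcard _ (Finset.mem_range.1 hh) hH)
            _ = (∑ h ∈ Finset.range M.H, (Z h).card) * N := (Finset.sum_mul _ _ _).symm
            _ ≤ N ^ 2 := by rw [sq]; exact Nat.mul_le_mul_right N hsum
      _ = ENNReal.ofReal δ := by
          rw [← ENNReal.ofReal_natCast, ← ENNReal.ofReal_mul (Nat.cast_nonneg _)]
          congr 1
          push_cast
          exact mul_div_cancel₀ _ (by positivity)
  refine le_trans (measure_mono_ae ?_) hbad
  filter_upwards [hgood] with ω ⟨h1, h2, h3⟩ hω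
  by_contra hnot
  refine hω ⟨h1, fun t ht h => ?_⟩
  obtain ⟨g, hg, hgc⟩ := hcov h _ (h1 t h)
  obtain ⟨f, hf, hfc⟩ := hcov (h + 1) _ (h1 t (h + 1))
  have hnb : ω ∉ Bad t h g f := fun hB => hnot (Set.mem_iUnion₂.2 ⟨t, Finset.mem_range.2 ht,
    Set.mem_iUnion₂.2 ⟨h, Finset.mem_univ _, Set.mem_iUnion₂.2 ⟨g, hg,
      Set.mem_iUnion₂.2 ⟨f, hf, hB⟩⟩⟩⟩)
  have hle := not_lt.1 (show ¬ (Real.log (1 / δ') < _) from hnb)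
  rw [hinv] at hle
  exact F.sum_integral_sq_residual_le hF (h1 t) ht.le hT (fun s => h3 s h) (h2 t h) (hZ _ _ hg)
    (hZ _ _ hf) hgc hfc (π := fun s => expl (run.fhat s ω)) hle

end Run

end MyopicRL

/-! ### Counting with the distributional Eluder dimension -/

namespace MyopicRL

section Eluder

/-- If the total weight of the predecessors of each index is less than `n θ`, then the indices can be
coloured with `n` colours such that the predecessors of each index in its own colour class have weight
at most `θ`. -/
theorem exists_coloring (I : Finset ℕ) (w : ℕ → ℕ → ℝ) {B θ : ℝ} {n : ℕ}
    (hB : ∀ i ∈ I, ∑ j ∈ I with j < i, w i j ≤ B) (hn : B < n * θ) :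
    ∃ col : ℕ → ℕ, (∀ i ∈ I, col i < n) ∧
      ∀ i ∈ I, ∑ j ∈ I with j < i ∧ col j = col i, w i j ≤ θ := by
  induction I using Finset.induction_on_max with
  | empty => exact ⟨fun _ => 0, by simp, by simp⟩
  | insert a s ha ih =>
    have hnot : a ∉ s := fun h => lt_irrefl a (ha a h)
    have hfil : ∀ i ∈ s, ∀ p : ℕ → Prop, ∀ [DecidablePred p],
        (insert a s).filter (fun j => j < i ∧ p j) = s.filter (fun j => j < i ∧ p j) := by
      intro i hi p _
      rw [Finset.filter_insert, if_neg fun h => (h.1.trans (ha i hi)).false]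
    obtain ⟨col, hcol, hs⟩ := ih fun i hi => by
      have h1 := hB i (Finset.mem_insert_of_mem hi)
      rwa [Finset.filter_insert, if_neg fun h => (h.trans (ha i hi)).false] at h1
    have hBa : ∑ j ∈ s, w a j ≤ B := by
      have h1 := hB a (Finset.mem_insert_self a s)
      rwa [Finset.filter_insert, if_neg (lt_irrefl a), Finset.filter_true_of_mem ha] at h1
    -- Pigeonhole: if every colour class had weight above θ, the total weight of the predecessors of
    -- `a` would be at least nθ > B. As `a` is the maximum, it is nobody's predecessor and the
    -- earlier colours stay valid.
    obtain ⟨c, hc, hcθ⟩ : ∃ c ∈ Finset.range n, ∑ j ∈ s with col j = c, w a j ≤ θ := by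
      by_contra! hcon
      have h1 : ∑ c ∈ Finset.range n, ∑ j ∈ s with col j = c, w a j = ∑ j ∈ s, w a j :=
        Finset.sum_fiberwise_of_maps_to (fun j hj => Finset.mem_range.2 (hcol j hj)) _
      have h2 : ∑ c ∈ Finset.range n, θ ≤ ∑ c ∈ Finset.range n, ∑ j ∈ s with col j = c, w a j :=
        Finset.sum_le_sum fun c hc => (hcon c hc).le
      rw [Finset.sum_const, Finset.card_range, nsmul_eq_mul, h1] at h2
      linarith
    have hne : ∀ j ∈ s, Function.update col a c j = col j := fun j hj =>
      Function.update_of_ne (fun h : j = a => hnot (h ▸ hj)) _ _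
    refine ⟨Function.update col a c, fun i hi => ?_, fun i hi => ?_⟩
    · rcases Finset.mem_insert.1 hi with rfl | hi
      · rw [Function.update_self]; exact Finset.mem_range.1 hc
      · rw [hne i hi]; exact hcol i hi
    · rcases Finset.mem_insert.1 hi with rfl | hi
      · rw [Finset.filter_insert, if_neg fun h => lt_irrefl i h.1, Function.update_self]
        refine le_trans (le_of_eq (Finset.sum_congr (Finset.filter_congr fun j hj => ?_)
          fun _ _ => rfl)) hcθ
        rw [hne j hj]
        exact ⟨fun h => h.2, fun h => ⟨ha j hj, h⟩⟩
      · rw [hfil i hi]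
        refine le_trans (le_of_eq (Finset.sum_congr (Finset.filter_congr fun j hj => ?_)
          fun _ _ => rfl)) (hs i hi)
        rw [hne j hj, hne i hi]

variable {S : Type*} [MeasurableSpace S]

/-- Listed in increasing order, the measures form an independent sequence at the scale θ ≥ θ₀, which
the definition of the dimension at θ₀ admits. -/
theorem card_le_of_dimDE {𝒢 : Set (S → ℝ)} {D : Set (Measure S)} {θ₀ θ : ℝ} {d : ℕ}
    (hd : dimDE 𝒢 D θ₀ ≤ d) (hθ₀ : θ₀ ≤ θ) (hθ : 0 ≤ θ) {I : Finset ℕ} {ρ : ℕ → Measure S}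
    {g : ℕ → S → ℝ} (hρ : ∀ i ∈ I, ρ i ∈ D) (hg : ∀ i ∈ I, g i ∈ 𝒢)
    (hlt : ∀ i ∈ I, θ < |∫ s, g i s ∂ρ i|)
    (hdep : ∀ i ∈ I, ∑ j ∈ I with j < i, (∫ s, g i s ∂ρ j) ^ 2 ≤ θ ^ 2) : I.card ≤ d := by
  have h1 : (I.card : ℕ∞) ≤ dimDE 𝒢 D θ₀ := by
    let e := I.orderEmbOfFin rfl
    have he : ∀ i, e i ∈ I := fun i => Finset.orderEmbOfFin_mem I rfl i
    refine le_iSup₂_of_le (f := fun (n : ℕ) _ => (n : ℕ∞)) I.card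
      ⟨fun i => ρ (e i), fun i => hρ _ (he i), θ, hθ₀, fun i => ?_⟩ le_rfl
    refine ⟨g (e i), hg _ (he i), ?_, hlt _ (he i)⟩
    refine (Real.sqrt_le_left hθ).2 (le_trans ?_ (hdep _ (he i)))
    have hinj : Function.Injective fun j : Fin i => e (Fin.castLE i.isLt.le j) :=
      e.injective.comp (Fin.castLE_injective _)
    rw [← Finset.sum_image (f := fun j => (∫ s, g (e i) s ∂ρ j) ^ 2)
      (g := fun j : Fin i => e (Fin.castLE i.isLt.le j)) hinj.injOn]
    refine Finset.sum_le_sum_of_subset_of_nonneg (fun j hj => ?_) fun _ _ _ => sq_nonneg _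
    obtain ⟨k, _, rfl⟩ := Finset.mem_image.1 hj
    refine Finset.mem_filter.2 ⟨he _, e.strictMono ?_⟩
    exact Fin.lt_def.2 k.isLt
  exact_mod_cast h1.trans hd

/-- A bound on the number of large means in a sequence whose past means are square-summable. -/
theorem card_le_mul_of_dimDE {𝒢 : Set (S → ℝ)} {D : Set (Measure S)} {θ₀ θ B : ℝ} {d n : ℕ}
    (hd : dimDE 𝒢 D θ₀ ≤ d) (hθ₀ : θ₀ ≤ θ) (hθ : 0 ≤ θ) {I : Finset ℕ} {ρ : ℕ → Measure S}
    {g : ℕ → S → ℝ} (hρ : ∀ i ∈ I, ρ i ∈ D) (hg : ∀ i ∈ I, g i ∈ 𝒢)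
    (hlt : ∀ i ∈ I, θ < |∫ s, g i s ∂ρ i|)
    (hB : ∀ i ∈ I, ∑ j ∈ I with j < i, (∫ s, g i s ∂ρ j) ^ 2 ≤ B) (hn : B < n * θ ^ 2) :
    I.card ≤ n * d := by
  -- Each of the n colour classes is an independent sequence at scale θ, hence has at most d
  -- elements.
  obtain ⟨col, hcol, hsum⟩ := exists_coloring I (fun i j => (∫ s, g i s ∂ρ j) ^ 2) hB hn
  have h1 : ∀ c ∈ Finset.range n, (I.filter fun i => col i = c).card ≤ d := by
    intro c _
    refine card_le_of_dimDE hd hθ₀ hθ (ρ := ρ) (g := g)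
      (fun i hi => hρ i (Finset.mem_filter.1 hi).1) (fun i hi => hg i (Finset.mem_filter.1 hi).1)
      (fun i hi => hlt i (Finset.mem_filter.1 hi).1) fun i hi => ?_
    obtain ⟨hiI, rfl⟩ := Finset.mem_filter.1 hi
    refine le_trans (le_of_eq (Finset.sum_congr ?_ fun _ _ => rfl)) (hsum i hiI)
    rw [Finset.filter_filter]
    exact Finset.filter_congr fun j _ => and_comm
  rw [Finset.card_eq_sum_card_fiberwise fun i hi => Finset.mem_coe.2 (Finset.mem_range.2 (hcol i hi))]
  exact (Finset.sum_le_card_nsmul _ _ _ h1).trans (by simp)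

end Eluder

/-- A weak-`L²` bound on the level sets gives a bound on the sum. -/
theorem sum_le_two_mul_sqrt {ι : Type*} (S : Finset ι) {r : ι → ℝ} {Q : ℝ} (hr : ∀ i ∈ S, 0 ≤ r i)
    (hQ : ∀ i ∈ S, ((S.filter fun j => r i ≤ r j).card : ℝ) * r i ^ 2 ≤ Q) :
    ∑ i ∈ S, r i ≤ 2 * √(Q * S.card) := by
  classical
  induction hn : S.card generalizing S with
  | zero => rw [Finset.card_eq_zero.1 hn]; simp
  | succ n ih =>
    obtain ⟨i, hi, hmin⟩ := S.exists_min_image r (Finset.card_pos.1 (by omega))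
    have h1 := hQ i hi
    -- The level set of a minimal element is all of S, so the smallest value is at most √(Q/(n+1));
    -- it is removed, and the sum of 1/√k up to n is at most 2√n.
    rw [Finset.filter_true_of_mem hmin, hn] at h1
    have hQ0 : 0 ≤ Q := le_trans (by positivity) h1
    have h2 := ih (S.erase i) (fun j hj => hr j (Finset.mem_of_mem_erase hj))
      (fun j hj => (mul_le_mul_of_nonneg_right (Nat.cast_le.2 (Finset.card_le_card
        (Finset.filter_subset_filter _ (Finset.erase_subset i S)))) (sq_nonneg _)).trans
          (hQ j (Finset.mem_of_mem_erase hj)))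
      (by rw [Finset.card_erase_of_mem hi, hn]; rfl)
    rw [← Finset.add_sum_erase S r hi]
    rw [Real.sqrt_mul hQ0] at h2 ⊢
    have ha : 0 < √((n + 1 : ℕ) : ℝ) := Real.sqrt_pos.2 (by positivity)
    have hb : 0 ≤ √(n : ℝ) := Real.sqrt_nonneg _
    have ha2 : √((n + 1 : ℕ) : ℝ) ^ 2 = n + 1 := by rw [Real.sq_sqrt (by positivity)]; push_cast; rfl
    have hb2 : √(n : ℝ) ^ 2 = n := Real.sq_sqrt (Nat.cast_nonneg n)
    have hab : √(n : ℝ) ≤ √((n + 1 : ℕ) : ℝ) := Real.sqrt_le_sqrt (by push_cast; linarith)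
    have hri : √((n + 1 : ℕ) : ℝ) * r i ≤ √Q := by
      refine Real.le_sqrt_of_sq_le ?_
      rw [mul_pow, ha2]
      push_cast at h1
      exact h1
    set a := √((n + 1 : ℕ) : ℝ)
    set b := √(n : ℝ)
    -- The inequality 1 ≤ 2a(a - b) behind this is 2a(a - b) = (a - b)² + (a² - b²), with a² - b² =
    -- 1.
    have h3 : a * (r i + 2 * (√Q * b)) ≤ a * (2 * (√Q * a)) := by
      have h4 : 0 ≤ √Q * (a - b) ^ 2 := by positivity
      have h5 : √Q * (a ^ 2 - b ^ 2) = √Q := by rw [ha2, hb2]; ring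
      nlinarith
    linarith [le_of_mul_le_mul_left h3 ha]

end MyopicRL

/-! ### Number of suboptimal episodes and the greedy regret -/

namespace MyopicRL

theorem sq_integral_le_integral_sq {S : Type*} [MeasurableSpace S] {ν : Measure S}
    [IsProbabilityMeasure ν] {g : S → ℝ} (hg : Integrable g ν)
    (hg2 : Integrable (fun s => g s ^ 2) ν) : (∫ s, g s ∂ν) ^ 2 ≤ ∫ s, g s ^ 2 ∂ν := by
  set m := ∫ s, g s ∂ν with hm
  have h1 : 0 ≤ ∫ s, (g s - m) ^ 2 ∂ν := integral_nonneg fun s => sq_nonneg _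
  have h2 : ∫ s, (g s - m) ^ 2 ∂ν = ∫ s, g s ^ 2 ∂ν - 2 * m * m + m ^ 2 := by
    have h3 : ∀ s, (g s - m) ^ 2 = g s ^ 2 - 2 * m * g s + m ^ 2 := fun s => by ring
    simp_rw [h3]
    have i1 : Integrable (fun s => g s ^ 2 - 2 * m * g s) ν := hg2.sub (hg.const_mul _)
    rw [integral_add i1 (integrable_const _), integral_sub hg2 (hg.const_mul _),
      integral_const_mul, ← hm]
    simp
  nlinarith

variable {X : Type u} {A : Type v} [MeasurableSpace X] [MeasurableSpace A]
  [MeasurableSingletonClass A] [Fintype A] [Nonempty A] {M : MDP X A} {F : FnClass M}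

/-- A function with a large gap has a policy which is dominated by its exploration policy and which
detects a Bellman error. -/
theorem Greedy.exists_large_residual (hM : M.RewardBounded) (G : Greedy F)
    {expl : ValueFn X A → Policy X A} {q l : ℝ} (hq : 0 < q) (hl : 0 < l)
    (hgap : ((q * l : ℝ) : EReal) ≤ gapOn G expl (G.suboptimal l)) {f : ValueFn X A}
    (hf : f ∈ G.suboptimal l) :
    ∃ c : ℝ, 1 ≤ c ∧ c < 4 / (q * l) ^ 2 ∧ ∃ h : Fin M.H, ∃ π ∈ G.policies,
      (∀ f' ∈ F.fns, ∫ p, M.residual h f' p ^ 2 ∂M.occ π h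
        ≤ c * ∫ p, M.residual h f' p ^ 2 ∂M.occ (expl f) h) ∧
      √c * (q * l / (4 * M.H)) < |∫ p, M.residual h f p ∂M.occ π h| := by
  have hql : 0 < q * l := mul_pos hq hl
  -- The gap is a supremum that need not be attained; half of the lower bound lies strictly below it
  -- and so has a witness.
  have h1 : ((q * l / 2 : ℝ) : EReal) < gap G expl G.policies f :=
    (EReal.coe_lt_coe_iff.2 (half_lt_self hql)).trans_le (hgap.trans (iInf₂_le f hf))
  unfold gap at h1
  simp only [lt_iSup_iff] at h1
  obtain ⟨π', hπ', c, hc, hdom, hlt⟩ := h1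
  rw [EReal.coe_lt_coe_iff] at hlt
  have hc0 : 0 < √c := Real.sqrt_pos.2 (by linarith)
  have hlt' : √c * (q * l / 2) < M.ret π' - M.ret (G.policy f) := by
    rw [one_div, lt_inv_mul_iff₀ hc0] at hlt
    exact hlt
  refine ⟨c, hc, ?_, ?_⟩
  -- Returns lie in [0, 1], so the advantage of π' is at most 1; this bounds c and makes the number
  -- of dyadic scales finite.
  · have h2 : √c * (q * l / 2) < 1 := by
      linarith [hM.ret_le_one π', hM.ret_nonneg (G.policy f)]
    have h3 : (√c * (q * l / 2)) ^ 2 < 1 := by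
      rw [sq_lt_one_iff_abs_lt_one, abs_of_pos (by positivity)]
      exact h2
    rw [mul_pow, Real.sq_sqrt (by linarith)] at h3
    rw [lt_div_iff₀ (by positivity)]
    linarith
  · have h2 := hlt'.trans_le (G.ret_sub_ret_le hM hf.1 π')
    -- If all mean residuals of both policies were at most √c·ql/(4H), the 2H terms of the
    -- decomposition would add up to at most √c·ql/2, against the strict lower bound.
    by_contra! hcon
    have h3 : ∀ h : Fin M.H, (∫ p, M.residual h f p ∂M.occ (G.policy f) h
        - ∫ p, M.residual h f p ∂M.occ π' h) ≤ 2 * (√c * (q * l / (4 * M.H))) := by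
      intro h
      have h4 := hcon h _ (Set.mem_image_of_mem _ hf.1) fun f' hf' => (hdom f' hf' h).2
      have h5 := hcon h _ hπ' fun f' hf' => (hdom f' hf' h).1
      linarith [(abs_le.1 h4).2, (abs_le.1 h5).1]
    have h4 := h2.trans_le (Finset.sum_le_sum fun h _ => h3 h)
    rw [Finset.sum_const, Finset.card_univ, Fintype.card_fin, nsmul_eq_mul] at h4
    rcases Nat.eq_zero_or_pos M.H with hH | hH
    · rw [hH, Nat.cast_zero, zero_mul] at h4
      exact absurd h4 (not_lt.2 (by positivity))
    · have hHR : (0 : ℝ) < M.H := by exact_mod_cast hH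
      refine absurd h4 (not_lt.2 (le_of_eq ?_))
      field_simp
      norm_num

/-- A bound on the number of the episodes in which the estimate is `l`-suboptimal. -/
theorem Greedy.card_suboptimal_le (hM : M.RewardBounded) (hF : F.Complete) (G : Greedy F)
    {expl : ValueFn X A → Policy X A} {q l β θ₀ : ℝ} (hq : 0 < q) (hl : 0 < l)
    (hgap : ((q * l : ℝ) : EReal) ≤ gapOn G expl (G.suboptimal l))
    {d J T : ℕ} (hd : dimBE F G.policies θ₀ = d) (hθ : θ₀ ≤ q * l / (4 * M.H)) (hβ : 0 ≤ β)
    (hJ : 4 / (q * l) ^ 2 ≤ 2 ^ J) {f : ℕ → ValueFn X A} (hf : ∀ t, f t ∈ F.fns)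
    (hres : ∀ t < T, ∀ h : Fin M.H, ∑ s ∈ Finset.range t,
      ∫ p, M.residual h (f t) p ^ 2 ∂M.occ (expl (f s)) h ≤ β) :
    (((Finset.range T).filter fun t => l ≤ M.optRet - M.ret (G.policy (f t))).card : ℝ)
      ≤ (2 * β / (q * l / (4 * M.H)) ^ 2 + 1) * d * (M.H * J) := by
  set S := (Finset.range T).filter fun t => l ≤ M.optRet - M.ret (G.policy (f t)) with hS
  have hql : 0 < q * l := mul_pos hq hl
  set η := q * l / (4 * M.H) with hη
  have hη0 : 0 ≤ η := by positivity
  rcases S.eq_empty_or_nonempty with h0 | ⟨t₀, ht₀⟩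
  · rw [h0, Finset.card_empty, Nat.cast_zero]
    positivity
  have hex : ∀ t ∈ S, ∃ c : ℝ, 1 ≤ c ∧ c < 4 / (q * l) ^ 2 ∧ ∃ h : Fin M.H, ∃ π ∈ G.policies,
      (∀ f' ∈ F.fns, ∫ p, M.residual h f' p ^ 2 ∂M.occ π h
        ≤ c * ∫ p, M.residual h f' p ^ 2 ∂M.occ (expl (f t)) h) ∧
      √c * η < |∫ p, M.residual h (f t) p ∂M.occ π h| := fun t ht =>
    G.exists_large_residual hM hq hl hgap ⟨hf t, (Finset.mem_filter.1 ht).2⟩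
  have hne : Nonempty (Fin M.H) := by
    obtain ⟨_, _, _, h, _⟩ := hex t₀ ht₀
    exact ⟨h⟩
  have hneP : Nonempty (Policy X A) := ⟨G.policy (f t₀)⟩
  have hHR : (0 : ℝ) < M.H := by exact_mod_cast Fin.pos_iff_nonempty.2 hne
  have hηpos : 0 < η := by positivity
  choose! c hc1 hc2 hh π hπ hdom hlarge using hex
  -- The dyadic scale of the domination constant: 2^j ≤ c < 2^(j+1).
  let j : ℕ → ℕ := fun t => Nat.log 2 ⌊c t⌋₊
  have hjle : ∀ t ∈ S, (2 : ℝ) ^ j t ≤ c t := fun t ht => by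
    have h1 : 2 ^ j t ≤ ⌊c t⌋₊ :=
      Nat.pow_log_le_self 2 (Nat.floor_pos.2 (hc1 t ht)).ne'
    have h2 : ((2 ^ j t : ℕ) : ℝ) ≤ c t :=
      (Nat.cast_le.2 h1).trans (Nat.floor_le (by linarith [hc1 t ht]))
    exact_mod_cast h2
  have hjlt : ∀ t ∈ S, c t < (2 : ℝ) ^ (j t + 1) := fun t ht => by
    have h1 : ⌊c t⌋₊ + 1 ≤ 2 ^ (j t + 1) := Nat.lt_pow_succ_log_self one_lt_two _
    have h2 : ((⌊c t⌋₊ + 1 : ℕ) : ℝ) ≤ ((2 ^ (j t + 1) : ℕ) : ℝ) := Nat.cast_le.2 h1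
    push_cast at h2
    exact (Nat.lt_floor_add_one _).trans_le h2
  have hjJ : ∀ t ∈ S, j t < J := fun t ht =>
    (pow_lt_pow_iff_right₀ (one_lt_two (α := ℝ))).1
      ((hjle t ht).trans_lt ((hc2 t ht).trans_le hJ))
  let n : ℕ := ⌊2 * β / η ^ 2⌋₊ + 1
  have hn : 2 * β / η ^ 2 < n := by
    have := Nat.lt_floor_add_one (2 * β / η ^ 2)
    push_cast [n]
    exact this
  have hn' : (n : ℝ) ≤ 2 * β / η ^ 2 + 1 := by
    push_cast [n]
    linarith [Nat.floor_le (show 0 ≤ 2 * β / η ^ 2 by positivity)]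
  have hcard : S.card ≤ n * d * ((Finset.univ : Finset (Fin M.H)) ×ˢ Finset.range J).card := by
    refine Finset.card_le_mul_card_image_of_maps_to (f := fun t => (hh t, j t))
      (fun t ht => Finset.mem_product.2 ⟨Finset.mem_univ _, Finset.mem_range.2 (hjJ t ht)⟩) _ ?_
    rintro ⟨h₁, j₁⟩ _
    have hmem : ∀ t ∈ S.filter (fun t => (hh t, j t) = (h₁, j₁)), t ∈ S ∧ hh t = h₁ ∧ j t = j₁ := by
      intro t ht
      obtain ⟨h1, h2⟩ := Finset.mem_filter.1 ht
      exact ⟨h1, congrArg Prod.fst h2, congrArg Prod.snd h2⟩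
    have hdim : dimDE (M.residual h₁ '' F.fns) ((fun π => M.occ π h₁) '' G.policies) θ₀ ≤ d := by
      rw [← hd]
      exact le_iSup (fun h : Fin M.H => dimDE (M.residual h '' F.fns)
        ((fun π => M.occ π h) '' G.policies) θ₀) h₁
    have hsq : √((2 : ℝ) ^ j₁) ^ 2 = 2 ^ j₁ := Real.sq_sqrt (by positivity)
    -- At scale j₁ the mean exceeds θ = √(2^j₁)·η. By Jensen and domination, the past squared means
    -- are at most 2^(j₁+1) times the squared residuals under exploration. The ratio B/θ² = 2β/η² is
    -- the same at all scales, so one number n of colours serves every group.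
    refine card_le_mul_of_dimDE hdim (θ := √((2 : ℝ) ^ j₁) * η) (B := 2 ^ (j₁ + 1) * β)
      (hθ.trans (le_mul_of_one_le_left hη0 (Real.one_le_sqrt.2 (one_le_pow₀ one_le_two))))
      (by positivity) (ρ := fun t => M.occ (π t) h₁) (g := fun t => M.residual h₁ (f t))
      (fun t ht => ⟨π t, hπ t (hmem t ht).1, rfl⟩) (fun t _ => ⟨f t, hf t, rfl⟩) ?_ ?_ ?_
    · intro t ht
      obtain ⟨h1, rfl, rfl⟩ := hmem t ht
      exact (mul_le_mul_of_nonneg_right (Real.sqrt_le_sqrt (hjle t h1)) hη0).trans_lt (hlarge t h1)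
    · intro t ht
      have htT : t < T := Finset.mem_range.1 (Finset.mem_filter.1 (hmem t ht).1).1
      refine le_trans ?_ (mul_le_mul_of_nonneg_left (hres t htT h₁)
        (by positivity : (0 : ℝ) ≤ 2 ^ (j₁ + 1)))
      rw [Finset.mul_sum]
      refine le_trans (Finset.sum_le_sum (g := fun s => 2 ^ (j₁ + 1)
        * ∫ p, M.residual h₁ (f t) p ^ 2 ∂M.occ (expl (f s)) h₁) fun s hs => ?_)
        (Finset.sum_le_sum_of_subset_of_nonneg (fun s hs =>
          Finset.mem_range.2 (Finset.mem_filter.1 hs).2) fun s _ _ =>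
          mul_nonneg (by positivity) (integral_nonneg fun p => sq_nonneg _))
      obtain ⟨h1, h2, h3⟩ := hmem s (Finset.mem_filter.1 hs).1
      have hint : Integrable (M.residual h₁ (f t)) (M.occ (π s) h₁) :=
        Integrable.of_bound (F.measurable_residual hF (hf t) h₁.2).aestronglyMeasurable 1
          (Filter.Eventually.of_forall fun p => abs_le.2 (F.residual_mem_Icc hF (hf t) h₁.2 p))
      refine (sq_integral_le_integral_sq hint
        (F.integrable_sq_residual hF (hf t) h₁.2 _)).trans ?_
      have h4 := hdom s h1 _ (hf t)
      rw [h2] at h4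
      refine h4.trans (mul_le_mul_of_nonneg_right ?_ (integral_nonneg fun p => sq_nonneg _))
      rw [← h3]
      exact (hjlt s h1).le
    · rw [mul_pow, hsq]
      rw [div_lt_iff₀ (by positivity)] at hn
      have h1 := mul_lt_mul_of_pos_left hn (by positivity : (0 : ℝ) < 2 ^ j₁)
      rw [pow_succ]
      linarith
  rw [Finset.card_product, Finset.card_univ, Fintype.card_fin, Finset.card_range] at hcard
  calc (S.card : ℝ) ≤ ((n * d * (M.H * J) : ℕ) : ℝ) := Nat.cast_le.2 hcard
    _ = (n : ℝ) * d * (M.H * J) := by push_cast; ring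
    _ ≤ _ := by gcongr

/-- The regret of the greedy policies of estimates with small squared Bellman residuals. -/
theorem Greedy.sum_suboptimality_le (hM : M.RewardBounded) (hF : F.Complete) (G : Greedy F)
    {expl : ValueFn X A → Policy X A} {q β D : ℝ} (hq : 0 < q)
    (hgap : ∀ l ∈ Set.Icc (0 : ℝ) 1, ((q * l : ℝ) : EReal) ≤ gapOn G expl (G.suboptimal l))
    {d J T : ℕ} (hT : 1 ≤ T) (hd : dimBE F G.policies (1 / √(T : ℝ)) = d) (hdD : (d : ℝ) ≤ D)
    (hD : 1 ≤ D) (hβ : 1 ≤ β) (hH : 1 ≤ M.H)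
    (hJ1 : 1 ≤ J) (hJ : 4 * (T : ℝ) ^ 2 / q ^ 2 ≤ 2 ^ J) {f : ℕ → ValueFn X A}
    (hf : ∀ t, f t ∈ F.fns)
    (hres : ∀ t < T, ∀ h : Fin M.H, ∑ s ∈ Finset.range t,
      ∫ p, M.residual h (f t) p ^ 2 ∂M.occ (expl (f s)) h ≤ β) :
    ∑ t ∈ Finset.range T, (M.optRet - M.ret (G.policy (f t)))
      ≤ 1 + 2 * √((32 * β * M.H ^ 2 / q ^ 2 + 1) * D * (M.H * J) * T) := by
  have hTR : (1 : ℝ) ≤ T := by exact_mod_cast hT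
  have hHR : (1 : ℝ) ≤ M.H := by exact_mod_cast hH
  have hJR : (1 : ℝ) ≤ J := by exact_mod_cast hJ1
  set r : ℕ → ℝ := fun t => M.optRet - M.ret (G.policy (f t)) with hr
  have hr0 : ∀ t, 0 ≤ r t := fun t => sub_nonneg.2 (hM.ret_le_optRet _)
  have hr1 : ∀ t, r t ≤ 1 := fun t => by
    linarith [hM.optRet_le_one, hM.ret_nonneg (G.policy (f t))]
  set Q : ℝ := (32 * β * M.H ^ 2 / q ^ 2 + 1) * D * (M.H * J) with hQ
  have hQ0 : 0 ≤ Q := by positivity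
  -- If the detection threshold is at least the scale 1/√T at which the dimension is known, the
  -- count above applies; multiplied by l² it is free of l, up to a term l² ≤ 1.
  have hlev : ∀ l : ℝ, 1 / T ≤ l → l ≤ 1 →
      (((Finset.range T).filter fun t => l ≤ r t).card : ℝ) * l ^ 2 ≤ Q := by
    intro l hl hl1
    have hl0 : 0 < l := lt_of_lt_of_le (by positivity) hl
    rcases le_or_gt (1 / √(T : ℝ)) (q * l / (4 * M.H)) with hcase | hcase
    · have h1 : 4 / (q * l) ^ 2 ≤ 2 ^ J := by
        refine le_trans ?_ hJ
        rw [div_le_div_iff₀ (by positivity) (by positivity)]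
        have h2 : 1 ≤ T * l := by
          rw [div_le_iff₀ (by positivity)] at hl
          linarith
        have h3 : 1 ≤ (T * l) ^ 2 := one_le_pow₀ h2
        nlinarith [mul_le_mul_of_nonneg_left h3 (sq_nonneg q)]
      have h2 := G.card_suboptimal_le hM hF hq hl0 (hgap l ⟨hl0.le, hl1⟩) hd hcase
        (by linarith) h1 hf hres
      calc _ ≤ (2 * β / (q * l / (4 * M.H)) ^ 2 + 1) * d * (M.H * J) * l ^ 2 :=
            mul_le_mul_of_nonneg_right h2 (sq_nonneg l)
        _ = (32 * β * M.H ^ 2 / q ^ 2 + l ^ 2) * d * (M.H * J) := by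
            field_simp
            ring
        _ ≤ Q := by
            have : l ^ 2 ≤ 1 := pow_le_one₀ hl0.le hl1
            rw [hQ]
            gcongr
    -- Below that scale the trivial count T suffices, since then T·l² ≤ 16H²/q².
    · have h1 : (q * l / (4 * M.H)) ^ 2 < 1 / T := by
        have h2 := pow_lt_pow_left₀ hcase (by positivity) two_ne_zero
        rwa [div_pow (1 : ℝ), one_pow, Real.sq_sqrt (by positivity)] at h2
      have h2 : T * l ^ 2 ≤ 16 * M.H ^ 2 / q ^ 2 := by
        rw [div_pow, div_lt_div_iff₀ (by positivity) (by positivity)] at h1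
        rw [le_div_iff₀ (by positivity)]
        linarith
      have h3 : (((Finset.range T).filter fun t => l ≤ r t).card : ℝ) ≤ T := by
        have := Finset.card_filter_le (Finset.range T) fun t => l ≤ r t
        rw [Finset.card_range] at this
        exact_mod_cast this
      have h4 : 16 * (M.H : ℝ) ^ 2 / q ^ 2 ≤ 32 * β * M.H ^ 2 / q ^ 2 + 1 := by
        have h5 : 16 * (M.H : ℝ) ^ 2 / q ^ 2 ≤ 32 * β * M.H ^ 2 / q ^ 2 := by
          gcongr
          linarith
        linarith
      calc _ ≤ (T : ℝ) * l ^ 2 := mul_le_mul_of_nonneg_right h3 (sq_nonneg l)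
        _ ≤ (32 * β * M.H ^ 2 / q ^ 2 + 1) * 1 * (1 * 1) := by linarith
        _ ≤ Q := by rw [hQ]; gcongr
  -- Episodes with gap below 1/T contribute at most 1 in total; the others have levels covered by
  -- `hlev`.
  rw [← Finset.sum_filter_add_sum_filter_not _ fun t => r t < 1 / (T : ℝ)]
  refine add_le_add ?_ ?_
  · calc _ ≤ ∑ t ∈ (Finset.range T).filter (fun t => r t < 1 / (T : ℝ)), 1 / (T : ℝ) :=
          Finset.sum_le_sum fun t ht => (Finset.mem_filter.1 ht).2.le
      _ ≤ ∑ t ∈ Finset.range T, 1 / (T : ℝ) :=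
          Finset.sum_le_sum_of_subset_of_nonneg (Finset.filter_subset _ _) fun _ _ _ => by positivity
      _ = 1 := by
          rw [Finset.sum_const, Finset.card_range, nsmul_eq_mul]
          field_simp
  · refine (sum_le_two_mul_sqrt _ (Q := Q) (fun t _ => hr0 t) fun t ht => ?_).trans ?_
    · refine le_trans ?_ (hlev (r t) (not_lt.1 (Finset.mem_filter.1 ht).2) (hr1 t))
      refine mul_le_mul_of_nonneg_right (Nat.cast_le.2 (Finset.card_le_card ?_)) (sq_nonneg _)
      exact Finset.filter_subset_filter _ (Finset.filter_subset _ _)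
    · gcongr
      have := Finset.card_filter_le (Finset.range T) fun t => ¬ r t < 1 / (T : ℝ)
      rw [Finset.card_range] at this
      exact this

end MyopicRL

/-! ### Explicit constants and rates -/

namespace MyopicRL

section Bounds

theorem sq_mul_rpow_half {κ x h : ℝ} (hx : 0 ≤ x) : (κ * x ^ (h / 2)) ^ 2 = κ ^ 2 * x ^ h := by
  rw [mul_pow, ← Real.rpow_natCast (x ^ (h / 2)), ← Real.rpow_mul hx]
  norm_num

/-- Since log T ≤ L and both log N and log(N/δ) are at most K, the radius is at most 36 + 64L +
128K, and each of 1, L, K is at most LK; 228 is the sum of the coefficients. -/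
theorem confidence_radius_le {T N δ a L K : ℝ} (hT : 1 ≤ T) (hN : 1 ≤ N) (hδ : 0 < δ)
    (hδ1 : δ < 1) (ha : 1 ≤ a) (hL : L = 1 + Real.log (a * T)) (hK : K = max 1 (Real.log (N / δ))) :
    1 ≤ 36 + 64 * Real.log (T * N ^ 2 / δ) ∧
      36 + 64 * Real.log (T * N ^ 2 / δ) ≤ 228 * (L * K) := by
  have h1 : Real.log (T * N ^ 2 / δ) = Real.log T + 2 * Real.log N - Real.log δ := by
    rw [Real.log_div (by positivity) hδ.ne', Real.log_mul (by positivity) (by positivity),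
      Real.log_pow]
    norm_num
  have h2 : Real.log (N / δ) = Real.log N - Real.log δ := Real.log_div (by positivity) hδ.ne'
  have h3 : Real.log (a * T) = Real.log a + Real.log T :=
    Real.log_mul (by positivity) (by positivity)
  have hla := Real.log_nonneg ha
  have hlT := Real.log_nonneg hT
  have hlN := Real.log_nonneg hN
  have hlδ : Real.log δ < 0 := Real.log_neg hδ hδ1
  have hK1 : 1 ≤ K := hK ▸ le_max_left _ _
  have hK2 : Real.log (N / δ) ≤ K := hK ▸ le_max_right _ _
  have hL1 : 1 ≤ L := by linarith
  constructor
  · linarith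
  · nlinarith [mul_nonneg (sub_nonneg.2 hL1) (sub_nonneg.2 hK1)]

/-- The logarithm of the largest possible c is linear in h log(A/ε), and ε ≥ 1/T turns log(1/ε) into
log T. This is the origin of the factor h in the regret. The factor 2 covers 1/log 2, and 7 = 2 · 3
+ 1 includes the rounding. -/
theorem exists_number_of_scales {κ ε a T h L : ℝ} (hκ : 0 < κ) (hT : 1 ≤ T) (hε : 1 / T ≤ ε)
    (ha : 1 ≤ a) (hh : 1 ≤ h) (hL : L = 1 + Real.log (a * T)) :
    ∃ J : ℕ, 1 ≤ J ∧ 4 * T ^ 2 / (κ * (ε / a) ^ (h / 2)) ^ 2 ≤ 2 ^ J ∧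
      (J : ℝ) ≤ (2 * |Real.log (4 / κ ^ 2)| + 7) * (h * L) := by
  have hε0 : 0 < ε := lt_of_lt_of_le (by positivity) hε
  set x := 4 * T ^ 2 / (κ * (ε / a) ^ (h / 2)) ^ 2 with hx
  have hx0 : 0 < x := by positivity
  refine ⟨⌊Real.logb 2 x⌋₊ + 1, by omega, ?_, ?_⟩
  · have h1 := (Nat.lt_floor_add_one (Real.logb 2 x)).le
    rw [Real.logb_le_iff_le_rpow one_lt_two hx0] at h1
    refine h1.trans (le_of_eq ?_)
    rw [← Real.rpow_natCast]
    push_cast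
    rfl
  · have hlogx : Real.log x = Real.log (4 / κ ^ 2) + 2 * Real.log T
        + h * (Real.log a - Real.log ε) := by
      rw [hx, sq_mul_rpow_half (by positivity), Real.log_div (by positivity) (by positivity),
        Real.log_mul (by positivity) (by positivity), Real.log_mul (by positivity) (by positivity),
        Real.log_rpow (by positivity), Real.log_div (by positivity) (by positivity),
        Real.log_div (by positivity) (by positivity), Real.log_pow]
      push_cast
      ring
    have hlε : -Real.log ε ≤ Real.log T := by
      have h1 := Real.log_le_log (by positivity) hε
      rw [one_div, Real.log_inv] at h1
      linarith
    have h3 : Real.log (a * T) = Real.log a + Real.log T :=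
      Real.log_mul (by positivity) (by positivity)
    have hla := Real.log_nonneg ha
    have hlT := Real.log_nonneg hT
    have hL1 : 1 ≤ L := by linarith
    have hhL : 1 ≤ h * L := one_le_mul_of_one_le_of_one_le hh hL1
    have habs := abs_nonneg (Real.log (4 / κ ^ 2))
    have hlx : Real.log x ≤ (|Real.log (4 / κ ^ 2)| + 3) * (h * L) := by
      have h4 : h * (Real.log a - Real.log ε) ≤ h * L :=
        mul_le_mul_of_nonneg_left (by linarith) (by linarith)
      have h5 : Real.log T ≤ h * L := by nlinarith
      have h6 := le_abs_self (Real.log (4 / κ ^ 2))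
      have h7 : |Real.log (4 / κ ^ 2)| ≤ |Real.log (4 / κ ^ 2)| * (h * L) :=
        le_mul_of_one_le_right habs hhL
      rw [hlogx]
      linarith
    have hb : Real.logb 2 x ≤ 2 * ((|Real.log (4 / κ ^ 2)| + 3) * (h * L)) := by
      rw [Real.logb, div_le_iff₀ (Real.log_pos one_lt_two)]
      have h8 := Real.log_two_gt_d9
      have h9 : 0 ≤ (|Real.log (4 / κ ^ 2)| + 3) * (h * L) := by positivity
      nlinarith
    have hfl : (⌊Real.logb 2 x⌋₊ : ℝ) ≤ 2 * ((|Real.log (4 / κ ^ 2)| + 3) * (h * L)) := by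
      rcases le_or_gt 0 (Real.logb 2 x) with h0 | h0
      · exact (Nat.floor_le h0).trans hb
      · rw [Nat.floor_of_nonpos h0.le, Nat.cast_zero]
        positivity
    push_cast
    linarith

/-- The constant in front of the regret bounds. -/
def regretConst (κ : ℝ) : ℝ :=
  1 + 2 * √(228 * (2 * |Real.log (4 / κ ^ 2)| + 7) * (32 / κ ^ 2 + 1))

theorem one_le_regretConst (κ : ℝ) : 1 ≤ regretConst κ :=
  le_add_of_nonneg_right (by positivity)

/-- As h ≥ 1, ε^h ≤ ε. The bound absorbs the additive 1 of the greedy regret and settles the case ε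
< 1/T. -/
theorem self_le_sqrt_regret {ε a T h D K H : ℝ} (hε0 : 0 < ε) (hε1 : ε ≤ 1) (hT : 1 ≤ T)
    (ha : 1 ≤ a) (hh : 1 ≤ h) (hD : 1 ≤ D) (hK : 1 ≤ K) (hH : 1 ≤ H) :
    √(T / ε) ≤ √(h * a ^ h * D * H ^ 3 * T / ε ^ h * K) := by
  refine Real.sqrt_le_sqrt ?_
  have h1 : ε ^ h ≤ ε := by
    have := Real.rpow_le_rpow_of_exponent_ge hε0 hε1 hh
    rwa [Real.rpow_one] at this
  have h2 : 1 ≤ a ^ h := Real.one_le_rpow ha (by linarith)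
  have h3 : 1 ≤ H ^ 3 := one_le_pow₀ hH
  have h4 : 0 < ε ^ h := by positivity
  calc T / ε ≤ T / ε ^ h := by gcongr
    _ = 1 * 1 * 1 * 1 * T / ε ^ h * 1 := by ring
    _ ≤ h * a ^ h * D * H ^ 3 * T / ε ^ h * K := by gcongr

/-- The radius and the number of scales contribute one factor L each; under the square root they
make L to the power 1. -/
theorem complexity_le {κ ε a T h L D K H J β : ℝ} (hκ : 0 < κ) (hε0 : 0 < ε) (hε1 : ε ≤ 1)
    (hT : 1 ≤ T) (ha : 1 ≤ a) (hh : 1 ≤ h) (hL : 1 ≤ L) (hD : 1 ≤ D) (hK : 1 ≤ K) (hH : 1 ≤ H)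
    (hβ : 1 ≤ β) (hβ' : β ≤ 228 * (L * K)) (hJ0 : 0 ≤ J)
    (hJ : J ≤ (2 * |Real.log (4 / κ ^ 2)| + 7) * (h * L)) :
    1 + 2 * √((32 * β * H ^ 2 / (κ * (ε / a) ^ (h / 2)) ^ 2 + 1) * D * (H * J) * T)
      ≤ regretConst κ * L ^ 1 * √(h * a ^ h * D * H ^ 3 * T / ε ^ h * K) := by
  have ha0 : 0 < a := by linarith
  have h1 : ε ^ h ≤ 1 := Real.rpow_le_one hε0.le hε1 (by linarith)
  have h2 : 1 ≤ a ^ h := Real.one_le_rpow ha (by linarith)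
  have h4 : 0 < ε ^ h := by positivity
  set W := h * a ^ h * D * H ^ 3 * T / ε ^ h * K with hW
  have hW1 : 1 ≤ √W := by
    refine le_trans ?_ (self_le_sqrt_regret hε0 hε1 hT ha hh hD hK hH)
    rw [Real.one_le_sqrt, one_le_div hε0]
    linarith
  set R := a ^ h / ε ^ h with hR
  have hR1 : 1 ≤ R := by rw [hR, one_le_div h4]; linarith
  have hq : (κ * (ε / a) ^ (h / 2)) ^ 2 = κ ^ 2 / R := by
    rw [sq_mul_rpow_half (by positivity), Real.div_rpow hε0.le ha0.le, hR]
    field_simp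
  set c₁ := 2 * |Real.log (4 / κ ^ 2)| + 7 with hc₁
  have hc₁0 : 0 ≤ c₁ := by positivity
  have hbound : (32 * β * H ^ 2 / (κ * (ε / a) ^ (h / 2)) ^ 2 + 1) * D * (H * J) * T
      ≤ (228 * c₁ * (32 / κ ^ 2 + 1)) * (L ^ 2 * W) := by
    have h5 : 32 * β * H ^ 2 / (κ * (ε / a) ^ (h / 2)) ^ 2 + 1
        ≤ (32 / κ ^ 2 + 1) * (228 * (L * K)) * H ^ 2 * R := by
      have h6 : 1 ≤ β * (H ^ 2 * R) := one_le_mul_of_one_le_of_one_le hβ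
        (one_le_mul_of_one_le_of_one_le (one_le_pow₀ hH) hR1)
      rw [hq]
      calc 32 * β * H ^ 2 / (κ ^ 2 / R) + 1 = 32 / κ ^ 2 * (β * (H ^ 2 * R)) + 1 := by
            field_simp
        _ ≤ 32 / κ ^ 2 * (β * (H ^ 2 * R)) + β * (H ^ 2 * R) := by linarith
        _ = (32 / κ ^ 2 + 1) * β * H ^ 2 * R := by ring
        _ ≤ _ := by gcongr
    calc _ ≤ ((32 / κ ^ 2 + 1) * (228 * (L * K)) * H ^ 2 * R) * D * (H * (c₁ * (h * L))) * T := by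
          gcongr
      _ = _ := by rw [hW, hR]; ring
  have hsqrt : √((32 * β * H ^ 2 / (κ * (ε / a) ^ (h / 2)) ^ 2 + 1) * D * (H * J) * T)
      ≤ √(228 * c₁ * (32 / κ ^ 2 + 1)) * (L * √W) := by
    refine (Real.sqrt_le_sqrt hbound).trans (le_of_eq ?_)
    rw [Real.sqrt_mul (show 0 ≤ 228 * c₁ * (32 / κ ^ 2 + 1) by positivity),
      Real.sqrt_mul (sq_nonneg L), Real.sqrt_sq (by linarith)]
  have hLW : 1 ≤ L * √W := one_le_mul_of_one_le_of_one_le hL hW1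
  calc _ ≤ L * √W + 2 * (√(228 * c₁ * (32 / κ ^ 2 + 1)) * (L * √W)) := by gcongr
    _ = _ := by rw [regretConst, pow_one]; ring

theorem regret_rate_eq {T h H Q : ℝ} (hT : 1 ≤ T) (hh : 1 ≤ h) (hH : 1 ≤ H) (hQ : 0 ≤ Q) :
    H ^ ((h + 3) / (h + 2)) * T ^ ((h + 1) / (h + 2)) * Q ^ (1 / (h + 2))
      = H * T * (H * Q / T) ^ (1 / (h + 2)) := by
  have h0 : h + 2 ≠ 0 := by linarith
  have e1 : (h + 3) / (h + 2) = 1 + 1 / (h + 2) := by field_simp; ring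
  have e2 : (h + 1) / (h + 2) = 1 - 1 / (h + 2) := by field_simp; ring
  have hH0 : 0 < H := by linarith
  have hT0 : 0 < T := by linarith
  rw [e1, e2, Real.rpow_add hH0, Real.rpow_sub hT0, Real.rpow_one, Real.rpow_one,
    Real.div_rpow (by positivity) hT0.le, Real.mul_rpow hH0.le hQ]
  ring

/-- B solves B^(h+2) = HQ/T, which makes εHT and the square-root term both equal to HTB, up to the
constant and logarithmic factors, at ε = B. Deviating from B costs ρ₂ in the first and ρ₁^(h/2) in
the second. -/
theorem regret_rate_le {reg ε a T h L D K H C B ρ₁ ρ₂ : ℝ} (hε0 : 0 < ε)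
    (hT : 1 ≤ T) (ha : 1 ≤ a) (hh : 1 ≤ h) (hL : 1 ≤ L) (hD : 1 ≤ D) (hK : 1 ≤ K) (hH : 1 ≤ H)
    (hC : 1 ≤ C) (hreg : reg ≤ ε * H * T + C * L ^ 1 * √(h * a ^ h * D * H ^ 3 * T / ε ^ h * K))
    (hregT : reg ≤ T) (hB : B = (h * H * a ^ h * D * K / T) ^ (1 / (h + 2))) (hρ₁ : 1 ≤ ρ₁)
    (hρ₂ : 1 ≤ ρ₂) (h1 : min 1 B / ρ₁ ≤ ε) (h2 : ε ≤ ρ₂ * B) :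
    reg ≤ C * L ^ 1 * (ρ₁ ^ (h / 2) + ρ₂) * (H ^ ((h + 3) / (h + 2)) * T ^ ((h + 1) / (h + 2))
      * (h * a ^ h * D * K) ^ (1 / (h + 2))) := by
  have ha0 : 0 < a := by linarith
  have hQ0 : 0 < h * a ^ h * D * K := by positivity
  rw [regret_rate_eq hT hh hH hQ0.le]
  set Q := h * a ^ h * D * K with hQ
  have hBQ : B = (H * Q / T) ^ (1 / (h + 2)) := by rw [hB, hQ]; congr 1; ring
  rw [← hBQ]
  have hB0 : 0 < B := by rw [hBQ]; positivity
  have hBpow : B ^ (h + 2) = H * Q / T := by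
    rw [hBQ, ← Real.rpow_mul (by positivity), one_div_mul_cancel (by linarith), Real.rpow_one]
  have hCL : 1 ≤ C * L := one_le_mul_of_one_le_of_one_le hC hL
  have hρh : 0 ≤ ρ₁ ^ (h / 2) := by positivity
  have hHTB : 0 ≤ H * T * B := by positivity
  rw [pow_one] at hreg ⊢
  rcases le_or_gt B 1 with hB1 | hB1
  · rw [min_eq_right hB1] at h1
    have hεh : (B / ρ₁) ^ h ≤ ε ^ h := Real.rpow_le_rpow (by positivity) h1 (by linarith)
    rw [Real.div_rpow hB0.le (by linarith)] at hεh
    have hs : √(h * a ^ h * D * H ^ 3 * T / ε ^ h * K) ≤ H * T * B * ρ₁ ^ (h / 2) := by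
      refine Real.sqrt_le_iff.2 ⟨by positivity, ?_⟩
      have e1 : h * a ^ h * D * H ^ 3 * T / ε ^ h * K = H ^ 2 * T ^ 2 * (H * Q / T) / ε ^ h := by
        rw [hQ]
        field_simp
      have e2 : B ^ (h + 2) = B ^ h * B ^ 2 := by
        rw [Real.rpow_add hB0]; norm_num
      rw [e1, ← hBpow, e2, sq_mul_rpow_half (by linarith)]
      calc H ^ 2 * T ^ 2 * (B ^ h * B ^ 2) / ε ^ h
          ≤ H ^ 2 * T ^ 2 * (B ^ h * B ^ 2) / (B ^ h / ρ₁ ^ h) := by gcongr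
        _ = (H * T * B) ^ 2 * ρ₁ ^ h := by field_simp
    have h3 : ε * H * T ≤ ρ₂ * (H * T * B) := by
      calc ε * H * T ≤ (ρ₂ * B) * H * T := by gcongr
        _ = _ := by ring
    calc reg ≤ ρ₂ * (H * T * B) + C * L * (H * T * B * ρ₁ ^ (h / 2)) :=
          hreg.trans (add_le_add h3 (mul_le_mul_of_nonneg_left hs (by linarith)))
      _ ≤ C * L * (ρ₂ * (H * T * B)) + C * L * (H * T * B * ρ₁ ^ (h / 2)) :=
          add_le_add (le_mul_of_one_le_left (by positivity) hCL) le_rfl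
      _ = _ := by ring
  -- For B > 1 the claimed bound exceeds T, which bounds the regret trivially.
  · calc reg ≤ 1 * 1 * (1 * T * 1) := by linarith
      _ ≤ C * L * (ρ₁ ^ (h / 2) + ρ₂) * (H * T * B) := by
          gcongr
          linarith

end Bounds

theorem Run.regret_le_of_residual {X : Type u} {A : Type v} [MeasurableSpace X] [MeasurableSpace A]
    [MeasurableSingletonClass A] [Fintype A] [Nonempty A] {M : MDP X A} {F : FnClass M}
    (hM : M.RewardBounded) (G : Greedy F) {ε : ℝ} (hε : ε ∈ Set.Icc (0 : ℝ) 1) {Ω : Type w}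
    [MeasurableSpace Ω] {μ : Measure Ω} (run : Run F (G.explore ε hε) μ) (T : ℕ) (ω : Ω) :
    run.regret T ω ≤ ε * M.H * T
      + ∑ t ∈ Finset.range T, (M.optRet - M.ret (G.policy (run.fhat t ω))) := by
  have h1 : ∀ t, M.optRet - M.ret (G.explore ε hε (run.fhat t ω))
      ≤ ε * M.H + (M.optRet - M.ret (G.policy (run.fhat t ω))) := fun t => by
    have := hM.ret_sub_le_ret_epsGreedy ε hε (G.act (run.fhat t ω)) (G.measurable _)
    rw [Greedy.explore, Greedy.policy]
    linarith
  refine (Finset.sum_le_sum fun t _ => h1 t).trans (le_of_eq ?_)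
  rw [Finset.sum_add_distrib, Finset.sum_const, Finset.card_range, nsmul_eq_mul]
  ring

theorem Run.regret_le {X : Type u} {A : Type v} [MeasurableSpace X] [MeasurableSpace A]
    [MeasurableSingletonClass A] [Fintype A] {M : MDP X A} {F : FnClass M}
    (hM : M.RewardBounded) {expl : ValueFn X A → Policy X A} {Ω : Type w}
    [MeasurableSpace Ω] {μ : Measure Ω} (run : Run F expl μ) (T : ℕ) (ω : Ω) :
    run.regret T ω ≤ T := by
  refine (Finset.sum_le_sum fun t _ => (?_ : _ ≤ (1 : ℝ))).trans (by simp)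
  linarith [hM.optRet_le_one, hM.ret_nonneg (expl (run.fhat t ω))]

end MyopicRL

end

/-! ### The regret bound of ε-greedy -/

theorem mainTheorem3 :
    ∃ p : ℕ, ∀ κ : ℝ, 0 < κ → ∃ C : ℝ, 0 < C ∧
      ∀ (X : Type u) [MeasurableSpace X]
        (A : Type v) [MeasurableSpace A] [MeasurableSingletonClass A] [Fintype A] [Nonempty A]
        (M : MyopicRL.MDP X A) (_ : M.RewardBounded)
        (F : MyopicRL.FnClass M) (_ : F.Complete) (G : MyopicRL.Greedy F)
        (T : ℕ) (_ : 1 ≤ T)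
        (ε : ℝ) (_ : 0 < ε) (hε : ε ∈ Set.Icc (0 : ℝ) 1)
        (Ω : Type w) [MeasurableSpace Ω] (μ : MeasureTheory.Measure Ω)
        [MeasureTheory.IsProbabilityMeasure μ]
        (run : MyopicRL.Run F (G.explore ε hε) μ)
        (h : ℝ) (_ : 1 ≤ h) (_ : h ≤ M.H)
        (_ : ∀ l ∈ Set.Icc (0 : ℝ) 1,
          ((κ * (ε / Fintype.card A) ^ (h / 2) * l : ℝ) : EReal)
            ≤ MyopicRL.gapOn G (G.explore ε hε) (G.suboptimal l))
        (d : ℕ) (_ : MyopicRL.dimBE F G.policies (1 / √(T : ℝ)) = d)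
        (N : ℕ) (_ : F.coverSum (1 / (T : ℝ)) = N)
        (δ : ℝ) (_ : 0 < δ) (_ : δ < 1)
        (L D K : ℝ) (_ : L = 1 + Real.log (Fintype.card A * T))
        (_ : D = max 1 (d : ℝ)) (_ : K = max 1 (Real.log (N / δ))),
        μ {ω | ¬ run.regret T ω ≤ ε * M.H * T
            + C * L ^ p * √(h * (Fintype.card A : ℝ) ^ h * D * (M.H : ℝ) ^ 3 * T / ε ^ h * K)}
          ≤ ENNReal.ofReal δ ∧
        ∀ B ρ₁ ρ₂ : ℝ,
          B = (h * M.H * (Fintype.card A : ℝ) ^ h * D * K / T) ^ (1 / (h + 2)) →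
          1 ≤ ρ₁ → 1 ≤ ρ₂ → min 1 B / ρ₁ ≤ ε → ε ≤ ρ₂ * B →
          μ {ω | ¬ run.regret T ω ≤ C * L ^ p * (ρ₁ ^ (h / 2) + ρ₂)
              * ((M.H : ℝ) ^ ((h + 3) / (h + 2)) * (T : ℝ) ^ ((h + 1) / (h + 2))
                * (h * (Fintype.card A : ℝ) ^ h * D * K) ^ (1 / (h + 2)))}
            ≤ ENNReal.ofReal δ := by
  refine ⟨1, fun κ hκ => ⟨MyopicRL.regretConst κ,
    zero_lt_one.trans_le (MyopicRL.one_le_regretConst κ), ?_⟩⟩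
  intro X _ A _ _ _ _ M hM F hF G T hT ε hε0 hε Ω _ μ _ run h hh hhH hgap d hd N hN δ hδ hδ1 L D K
    hL hD hK
  have hTR : (1 : ℝ) ≤ T := by exact_mod_cast hT
  have haR : (1 : ℝ) ≤ Fintype.card A := by exact_mod_cast Fintype.card_pos
  have hHR : (1 : ℝ) ≤ M.H := hh.trans hhH
  have hH : 1 ≤ M.H := by exact_mod_cast hHR
  have hD1 : 1 ≤ D := hD ▸ le_max_left _ _
  have hdD : (d : ℝ) ≤ D := hD ▸ le_max_right _ _
  have hK1 : 1 ≤ K := hK ▸ le_max_left _ _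
  have hL1 : 1 ≤ L := by
    rw [hL]
    linarith [Real.log_nonneg (one_le_mul_of_one_le_of_one_le haR hTR)]
  have hNpos : 0 < N := by
    obtain ⟨Z, -, hcov, -, hcard⟩ := MyopicRL.FnClass.exists_covers (F := F)
      (fun h hh => ⟨_, hF.realizable h hh⟩) (one_div_nonneg.2 (Nat.cast_nonneg T)) hN
    obtain ⟨g, hg, _⟩ := hcov 0 _ (hF.realizable 0 hH)
    exact (Finset.card_pos.2 ⟨g, hg⟩).trans_le (hcard 0 (Nat.zero_le _) hH)
  have hNR : (1 : ℝ) ≤ N := by exact_mod_cast hNpos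
  obtain ⟨hβ1, hβ⟩ := MyopicRL.confidence_radius_le hTR hNR hδ hδ1 haR hL hK
  have hmain : ∀ ω, ((∀ t, run.fhat t ω ∈ F.fns) ∧ ∀ t < T, ∀ h : Fin M.H,
      ∑ s ∈ Finset.range t, ∫ p, M.residual h (run.fhat t ω) p ^ 2
        ∂M.occ (G.explore ε hε (run.fhat s ω)) h
          ≤ 36 + 64 * Real.log (T * (N : ℝ) ^ 2 / δ)) →
      run.regret T ω ≤ ε * M.H * T + MyopicRL.regretConst κ * L ^ 1
        * √(h * (Fintype.card A : ℝ) ^ h * D * (M.H : ℝ) ^ 3 * T / ε ^ h * K) := by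
    rintro ω ⟨hf, hres⟩
    -- The number of scales is logarithmic only if ε ≥ 1/T; for smaller ε, T ≤ √(T/ε) and the claim
    -- is weaker than the trivial regret bound T.
    rcases le_or_gt (1 / (T : ℝ)) ε with hεT | hεT
    · obtain ⟨J, hJ1, hJ, hJle⟩ := MyopicRL.exists_number_of_scales hκ hTR hεT haR hh hL
      refine (run.regret_le_of_residual hM G hε T ω).trans (add_le_add le_rfl ?_)
      refine (G.sum_suboptimality_le hM hF (by positivity) hgap hT hd hdD hD1 hβ1 hH hJ1 hJ hf
        hres).trans ?_
      exact MyopicRL.complexity_le hκ hε0 hε.2 hTR haR hh hL1 hD1 hK1 hHR hβ1 hβ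
        (Nat.cast_nonneg J) hJle
    · refine (run.regret_le hM T ω).trans ?_
      have h1 : (T : ℝ) ≤ √(T / ε) := by
        refine Real.le_sqrt_of_sq_le ?_
        rw [le_div_iff₀ hε0]
        rw [lt_div_iff₀ (by positivity)] at hεT
        nlinarith
      have h2 := h1.trans (MyopicRL.self_le_sqrt_regret hε0 hε.2 hTR haR hh hD1 hK1 hHR)
      have h3 : 1 ≤ MyopicRL.regretConst κ * L ^ 1 := by
        rw [pow_one]
        exact one_le_mul_of_one_le_of_one_le (MyopicRL.one_le_regretConst κ) hL1
      have h4 : 0 ≤ ε * M.H * T := by positivity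
      nlinarith [Real.sqrt_nonneg
        (h * (Fintype.card A : ℝ) ^ h * D * (M.H : ℝ) ^ 3 * T / ε ^ h * K)]
  -- One event of probability at least 1 - δ serves both bounds.
  have hprob := run.measure_residual_le hM hF hT hN hδ
  refine ⟨le_trans (measure_mono ?_) hprob, ?_⟩
  · exact fun ω (hω : ¬ _) hgood => hω (hmain ω hgood)
  intro B ρ₁ ρ₂ hB hρ₁ hρ₂ h1 h2
  refine le_trans (measure_mono ?_) hprob
  exact fun ω (hω : ¬ _) hgood => hω (MyopicRL.regret_rate_le hε0 hTR haR hh hL1 hD1 hK1 hHR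
    (MyopicRL.one_le_regretConst κ) (hmain ω hgood) (run.regret_le hM T ω) hB hρ₁ hρ₂ h1 h2)
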